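/- **Setting.** For each $n$ let $Y_i=f(x_i)+\varepsilon_i$, $i=1,\dots,n$, with fixed design points $x_i$, true regression function $f$, and independent $\varepsilon_i\sim N(0,\sigma^2)$, $\sigma^2>0$ known ($x_i$, $f$, $\varepsilon_i$ may change with $n$). Let $\Gamma=\Gamma_n$ be a countable list of candidate models; model $k$ is a finite-dimensional linear family $\mathcal F_k$ of functions. Let $\mathbf Y_n=(Y_1,\dots,Y_n)^T$ and $f_n=(f(x_1),\dots,f(x_n))^T$; let $M_k$ be the orthogonal projection of $\mathbb R^n$ onto $\{(g(x_1),\dots,g(x_n))^T:g\in\mathcal F_k\}$, $r_k$ its rank, and $\mathrm{TSE}(k)=\|f_n-M_k\mathbf Y_n\|^2$. Let $S_1(k)$ be the set of $k'\in\Gamma$ with $\mathcal F_{k'}\subseteq\mathcal F_k$ and $r_{k'}=r_k-1$; assume $S_1(k)\neq\emptyset$ whenever $r_k>1$. Let $\lambda_n\ge(\log n)^{-1}$ (for $n\ge2$), $d\ge0$, and $$IC(k)=\|\mathbf Y_n-M_k\mathbf Y_n\|^2+\lambda_n\log(n)\,r_k\sigma^2-n\sigma^2+d\,n^{1/2}\log(n)\,\sigma^2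 .$$ For a random selected model $\hat k_n\in\Gamma_n$, the parametricness index is $$\mathrm{PI}_n=\inf_{k\in S_1(\hat k_n)}\left|\frac{IC(k)}{IC(\hat k_n)}\right|\ \text{ if } r_{\hat k_n}>1,\qquad \mathrm{PI}_n=n\ \text{ otherwise},$$ and $\mathrm{PI}^{\pm}_n$ denotes the same index without the absolute value. AIC and BIC select a minimizer over $k\in\Gamma_n$ of $\|\mathbf Y_n-M_k\mathbf Y_n\|^2+2r_k\sigma^2$ and of $\|\mathbf Y_n-M_k\mathbf Y_n\|^2+\log(n)r_k\sigma^2$, respectively (such minimizers are assumed to exist). A selection procedure $\tilde k_n$ is *asymptotically loss efficient* if $\mathrm{TSE}(\tilde k_n)/\inf_{k\in\Gamma_n}\mathrm{TSE}(k)\to1$ in probability. *Parametric scenario.* For all large $n$ there is a true model $k_n^*\in\Gamma_n$, i.e. $f\in\mathcal F_{k_n^*}$, with $r_{k_n^*}>1$. Put $A_n=\inf_{k\in S_1(k_n^*)}\|(I_n-M_k)f_n\|^2/\sigma^2$. * (P1) For some $0<\tau\le\frac12$, $A_n$ is of order $n^{1/2+\tau}$ or higher, i.e. $n^{1/2+\tau}=O(A_n)$.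 * (P2) $r_{k_n^*}\lambda_n\log n=o(n^{1/2+\tau})$, with the same $\tau$. * (P3) $P(\hat k_n=k_n^*)\to1$. *Nonparametric scenario.* For all large $n$, $f\notin\mathcal F_k$ for every $k\in\Gamma_n$. Put $$D_n(k)=(\lambda_n\log n-1)r_k+\|(I_n-M_k)f_n\|^2/\sigma^2+d\,n^{1/2}\log n,\qquad B_{j,n}=\inf_{k\in\Gamma_n,\,r_k=j}D_n(k),$$ let $N_j$ be the number of models of rank $j$ and $L_j=\sup_{r_k=j}\operatorname{card}S_1(k)$. There are integers $a_n\to\infty$, $b_n$, with $1\le a_n<b_n<n$ for all large $n$, such that the following hold. * (N1) $P(a_n\le r_{\hat k_n}\le b_n)\to1$ and $\sup_{a_n\le j\le b_n}B_{j,n}/(n-j)\to0$. * (N2) There are a positive sequence $\zeta_n\to0$ and $c_0>0$ such that, for all large $n$ and $a_n\le j\le b_n$, $N_jL_j\le c_0e^{\zeta_nB_{j,n}}$ and $N_j\le c_0e^{B_{j,n}^2/(10(n-j))}$; moreover $\sum_{j=a_n}^{b_n}e^{-B_{j,n}^2/(10(n-j))}\to0$. * (N3) $\displaystyle\sup_{k:\,a_n\le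 r_k\le b_n}\ \frac{\inf_{s\in S_1(k)}\|(M_k-M_s)f_n\|^2}{D_n(k)}\to0$. **Corollary (combining AIC and BIC).** Fix $c>1$ and let $\delta$ choose the AIC-selected model if $\mathrm{PI}_n<c$ and the BIC-selected model if $\mathrm{PI}_n\ge c$. In the parametric scenario, if (P1)–(P3) hold and BIC is asymptotically loss efficient, then $\delta$ is asymptotically loss efficient. In the nonparametric scenario, if (N1)–(N3) hold and AIC is asymptotically loss efficient, then $\delta$ is asymptotically loss efficient. The same holds with $\mathrm{PI}^{\pm}_n$ in place of $\mathrm{PI}_n$ in the nonparametric scenario, and in the parametric scenario when $d>0$. -/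

import Mathlib

open MeasureTheory ProbabilityTheory Filter Topology Asymptotics
open scoped ENNReal

noncomputable section

/-- The regression model `Y_i = f(x_i) + ε_i`, `i = 1, …, n`, with fixed design and independent
`N(0, σ²)` errors, at every sample size `n`, together with the list `Γ n` of candidate linear
models and the constants `λ_n`, `d` of the information criterion.
`X` is the covariate space. Design, regression function and errors may change with `n`. -/
structure RegressionSetup {Ω : Type*} [MeasurableSpace Ω] (μ : Measure Ω) (X : Type*)
    (Γ : ℕ → Type*) where
  /-- the design points `x_1, …, x_n` -/
  x : (n : ℕ) → Fin n → X
  /-- the true regression function at sample size `n` -/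
  f : ℕ → X → ℝ
  /-- the (known) noise level -/
  σ : ℝ
  σ_pos : 0 < σ
  /-- the random errors -/
  ε : (n : ℕ) → Fin n → Ω → ℝ
  ε_law : ∀ n i, HasLaw (ε n i) (gaussianReal 0 (σ ^ 2).toNNReal) μ
  ε_indep : ∀ n, iIndepFun (ε n) μ
  /-- the candidate model `k`: a finite-dimensional linear family of regression functions -/
  family : (n : ℕ) → Γ n → Submodule ℝ (X → ℝ)
  family_finite : ∀ n k, FiniteDimensional ℝ (family n k)
  /-- the sequence `λ_n ≥ 1 / log n` -/
  lam : ℕ → ℝ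
  lam_ge : ∀ n : ℕ, 2 ≤ n → (Real.log n)⁻¹ ≤ lam n
  /-- the constant `d ≥ 0` -/
  d : ℝ
  d_nonneg : 0 ≤ d

namespace RegressionSetup

variable {Ω : Type*} [MeasurableSpace Ω] {μ : Measure Ω} {X : Type*} {Γ : ℕ → Type*}
variable (S : RegressionSetup μ X Γ)

/-- Evaluation of a function at the design points, as a vector of Euclidean `ℝⁿ`. -/
def evalDesign (n : ℕ) : (X → ℝ) →ₗ[ℝ] EuclideanSpace ℝ (Fin n) :=
  (WithLp.linearEquiv 2 ℝ (Fin n → ℝ)).symm.toLinearMap ∘ₗ LinearMap.funLeft ℝ ℝ (S.x n)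

/-- The mean vector `f_n = (f(x_1), …, f(x_n))ᵀ`. -/
def mean (n : ℕ) : EuclideanSpace ℝ (Fin n) := S.evalDesign n (S.f n)

/-- The response vector `Y_n = f_n + e_n`. -/
def response (n : ℕ) (ω : Ω) : EuclideanSpace ℝ (Fin n) :=
  S.mean n + WithLp.toLp 2 (fun i => S.ε n i ω)

/-- The column space of model `k` (the values of its members at the design points). -/
def colSpace (n : ℕ) (k : Γ n) : Submodule ℝ (EuclideanSpace ℝ (Fin n)) :=
  (S.family n k).map (S.evalDesign n)

/-- The projection matrix `M_k`. -/
def proj (n : ℕ) (k : Γ n) : EuclideanSpace ℝ (Fin n) →L[ℝ] EuclideanSpace ℝ (Fin n) :=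
  (S.colSpace n k).starProjection

/-- The rank `r_k` of `M_k`. -/
def rank (n : ℕ) (k : Γ n) : ℕ := Module.finrank ℝ (S.colSpace n k)

/-- `S₁(k)`: the sub-models `k'` of `k` in the candidate list with `r_{k'} = r_k - 1`. -/
def subModels (n : ℕ) (k : Γ n) : Set (Γ n) :=
  {k' | S.family n k' ≤ S.family n k ∧ S.rank n k' + 1 = S.rank n k}

/-- The standing assumption on the candidate list: `S₁(k)` is nonempty whenever `r_k > 1`. -/
def HasSubModels : Prop := ∀ n (k : Γ n), 1 < S.rank n k → (S.subModels n k).Nonempty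

/-- The residual sum of squares `‖Y_n - M_k Y_n‖²`. -/
def RSS (n : ℕ) (k : Γ n) (ω : Ω) : ℝ :=
  ‖S.response n ω - S.proj n k (S.response n ω)‖ ^ 2

/-- The total square error `TSE(k) = ‖f_n - M_k Y_n‖²` of least squares in model `k`. -/
def TSE (n : ℕ) (k : Γ n) (ω : Ω) : ℝ := ‖S.mean n - S.proj n k (S.response n ω)‖ ^ 2

/-- The squared approximation error `‖(I_n - M_k) f_n‖²`. -/
def approxErr (n : ℕ) (k : Γ n) : ℝ := ‖S.mean n - S.proj n k (S.mean n)‖ ^ 2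

/-- The information criterion `IC_{λ_n, d}(k)` (with `σ` known). -/
def IC (n : ℕ) (k : Γ n) (ω : Ω) : ℝ :=
  S.RSS n k ω + S.lam n * Real.log n * S.rank n k * S.σ ^ 2 - n * S.σ ^ 2
    + S.d * Real.sqrt n * Real.log n * S.σ ^ 2

open Classical in
/-- The parametricness index `inf_{k ∈ S₁(k̂)} IC(k) / IC(k̂)` of a selected model `k̂`, with
the signed quotient; it is `n` if the rank of `k̂` is at most one. -/
def signedPI (n : ℕ) (khat : Ω → Γ n) (ω : Ω) : ℝ :=
  if 1 < S.rank n (khat ω) then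
    ⨅ k : S.subModels n (khat ω), S.IC n k ω / S.IC n (khat ω) ω
  else n

open Classical in
/-- The parametricness index `inf_{k ∈ S₁(k̂)} |IC(k) / IC(k̂)|` of a selected model `k̂`; it is
`n` if the rank of `k̂` is at most one. -/
def PI (n : ℕ) (khat : Ω → Γ n) (ω : Ω) : ℝ :=
  if 1 < S.rank n (khat ω) then
    ⨅ k : S.subModels n (khat ω), |S.IC n k ω / S.IC n (khat ω) ω|
  else n

/-- `k` is selected by AIC, with criterion `‖Y_n - M_k Y_n‖² + 2 r_k σ²`. -/
def IsAICSelected (n : ℕ) (k : Γ n) (ω : Ω) : Prop :=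
  ∀ k', S.RSS n k ω + 2 * S.rank n k * S.σ ^ 2 ≤ S.RSS n k' ω + 2 * S.rank n k' * S.σ ^ 2

/-- `k` is selected by BIC, with criterion `‖Y_n - M_k Y_n‖² + log(n) r_k σ²`. -/
def IsBICSelected (n : ℕ) (k : Γ n) (ω : Ω) : Prop :=
  ∀ k', S.RSS n k ω + Real.log n * S.rank n k * S.σ ^ 2
    ≤ S.RSS n k' ω + Real.log n * S.rank n k' * S.σ ^ 2

/-- A selection procedure is asymptotically loss efficient if the ratio of its loss to the
smallest loss over the candidate list tends to `1` in probability. -/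
def LossEfficient (sel : (n : ℕ) → Ω → Γ n) : Prop :=
  TendstoInMeasure μ (fun n ω => S.TSE n (sel n ω) ω / ⨅ k : Γ n, S.TSE n k ω) atTop
    (fun _ => (1 : ℝ))

/-! ### Parametric scenario -/

/-- For all large `n` the true model at sample size `n` is the candidate `kstar n`, and it has
rank larger than one. -/
def Parametric (kstar : (n : ℕ) → Γ n) : Prop :=
  ∀ᶠ n in atTop, S.f n ∈ S.family n (kstar n) ∧ 1 < S.rank n (kstar n)

/-- `A_n = inf_{k ∈ S₁(k*)} ‖(I_n - M_k) f_n‖² / σ²`. -/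
def A (kstar : (n : ℕ) → Γ n) (n : ℕ) : ℝ :=
  ⨅ k : S.subModels n (kstar n), S.approxErr n k / S.σ ^ 2

/-- `A_n` is of order `n^{1/2+τ}` or higher. -/
def CondP1 (kstar : (n : ℕ) → Γ n) (τ : ℝ) : Prop :=
  (fun n : ℕ => (n : ℝ) ^ (1 / 2 + τ)) =O[atTop] S.A kstar

/-- `r_{k*} λ_n log n = o(n^{1/2+τ})`. -/
def CondP2 (kstar : (n : ℕ) → Γ n) (τ : ℝ) : Prop :=
  (fun n : ℕ => S.rank n (kstar n) * S.lam n * Real.log n)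
    =o[atTop] (fun n : ℕ => (n : ℝ) ^ (1 / 2 + τ))

/-- Selection consistency. -/
def CondP3 (_S : RegressionSetup μ X Γ) (kstar : (n : ℕ) → Γ n) (khat : (n : ℕ) → Ω → Γ n) :
    Prop :=
  Tendsto (fun n => μ {ω | khat n ω = kstar n}) atTop (𝓝 1)

/-- Conditions (P1)–(P3). -/
def CondP (kstar : (n : ℕ) → Γ n) (khat : (n : ℕ) → Ω → Γ n) : Prop :=
  (∃ τ : ℝ, 0 < τ ∧ τ ≤ 1 / 2 ∧ S.CondP1 kstar τ ∧ S.CondP2 kstar τ) ∧ S.CondP3 kstar khat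

/-! ### Nonparametric scenario -/

/-- For all large `n` the true regression function is in none of the candidate models. -/
def Nonparametric : Prop := ∀ᶠ n in atTop, ∀ k : Γ n, S.f n ∉ S.family n k

/-- `(λ_n log n - 1) r_k + ‖(I_n - M_k) f_n‖² / σ² + d n^{1/2} log n`. -/
def size (n : ℕ) (k : Γ n) : ℝ :=
  (S.lam n * Real.log n - 1) * S.rank n k + S.approxErr n k / S.σ ^ 2
    + S.d * Real.sqrt n * Real.log n

/-- `B_{j,n}`: the infimum of `size` over the candidate models of rank `j`. (If there is no such
model the value is `0`; the last part of `CondN2` excludes this in the range where `B_{j,n}` is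
used.) -/
def B (n j : ℕ) : ℝ := ⨅ k : {k : Γ n // S.rank n k = j}, S.size n k

/-- `N_j`: the number of candidate models of rank `j`. -/
def N (n j : ℕ) : ℕ∞ := {k : Γ n | S.rank n k = j}.encard

/-- `L_j`: the largest cardinality of `S₁(k)` among the candidate models of rank `j`. -/
def L (n j : ℕ) : ℕ∞ := ⨆ k : {k : Γ n // S.rank n k = j}, (S.subModels n k).encard

/-- `P(a_n ≤ r_{k̂} ≤ b_n) → 1` and `sup_{a_n ≤ j ≤ b_n} B_{j,n} / (n - j) → 0` (the quotients
are nonnegative). -/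
def CondN1 (khat : (n : ℕ) → Ω → Γ n) (a b : ℕ → ℕ) : Prop :=
  Tendsto (fun n => μ {ω | a n ≤ S.rank n (khat n ω) ∧ S.rank n (khat n ω) ≤ b n}) atTop (𝓝 1) ∧
  ∀ η : ℝ, 0 < η → ∀ᶠ n in atTop, ∀ j, a n ≤ j → j ≤ b n → S.B n j / ((n : ℝ) - j) ≤ η

/-- The bounds on the numbers of models. -/
def CondN2 (a b : ℕ → ℕ) : Prop :=
  (∃ (ζ : ℕ → ℝ) (c₀ : ℝ), (∀ n, 0 < ζ n) ∧ Tendsto ζ atTop (𝓝 0) ∧ 0 < c₀ ∧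
    ∀ᶠ n in atTop, ∀ j, a n ≤ j → j ≤ b n →
      ((S.N n j * S.L n j : ℕ∞) : ℝ≥0∞) ≤ ENNReal.ofReal (c₀ * Real.exp (ζ n * S.B n j)) ∧
      (S.N n j : ℝ≥0∞) ≤
        ENNReal.ofReal (c₀ * Real.exp (S.B n j ^ 2 / (10 * ((n : ℝ) - j))))) ∧
  Tendsto (fun n : ℕ => ∑ j ∈ Finset.Icc (a n) (b n),
    Real.exp (-(S.B n j ^ 2 / (10 * ((n : ℝ) - j))))) atTop (𝓝 0)

/-- `sup_{a_n ≤ r_k ≤ b_n} inf_{s ∈ S₁(k)} ‖(M_k - M_s) f_n‖² / size(k) → 0` (the quotients are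
nonnegative). -/
def CondN3 (a b : ℕ → ℕ) : Prop :=
  ∀ η : ℝ, 0 < η → ∀ᶠ n in atTop, ∀ k : Γ n, a n ≤ S.rank n k → S.rank n k ≤ b n →
    (⨅ s : S.subModels n k, ‖S.proj n k (S.mean n) - S.proj n s (S.mean n)‖ ^ 2) / S.size n k ≤ η

/-- Conditions (N1)–(N3). -/
def CondN (khat : (n : ℕ) → Ω → Γ n) : Prop :=
  ∃ a b : ℕ → ℕ, (∀ᶠ n in atTop, 1 ≤ a n ∧ a n < b n ∧ b n < n) ∧ Tendsto a atTop atTop ∧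
    S.CondN1 khat a b ∧ S.CondN2 a b ∧ S.CondN3 a b

end RegressionSetup

open Classical in
/-- The procedure `δ`: take the AIC choice if the index is less than `c`, and the BIC choice
otherwise. -/
def combineSel {Ω : Type*} {Γ : ℕ → Type*} (c : ℝ) (index : (n : ℕ) → Ω → ℝ)
    (kAIC kBIC : (n : ℕ) → Ω → Γ n) (n : ℕ) (ω : Ω) : Γ n :=
  if index n ω < c then kAIC n ω else kBIC n ω

end

noncomputable section

/-! ### Tail bounds for the standard Gaussian measure -/

section StdGaussian

open Real

theorem integrable_exp_mul_sq_gaussianReal {t : ℝ} (ht : t < 1 / 2) :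
    Integrable (fun x : ℝ => exp (t * x ^ 2)) (gaussianReal 0 1) := by
  rw [gaussianReal_of_var_ne_zero _ one_ne_zero,
    integrable_withDensity_iff_integrable_smul' (measurable_gaussianPDF 0 1)
      (ae_of_all _ fun _ => gaussianPDF_lt_top)]
  have h := (integrable_exp_neg_mul_sq (b := 1 / 2 - t) (by linarith)).const_mul (√(2 * π))⁻¹
  refine h.congr (ae_of_all _ fun x => ?_)
  simp only [toReal_gaussianPDF, gaussianPDFReal_def, smul_eq_mul, mul_assoc, ← exp_add,
    NNReal.coe_one, mul_one]
  congr 2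
  ring

theorem integral_exp_mul_sq_gaussianReal {t : ℝ} (ht : t < 1 / 2) :
    ∫ x, exp (t * x ^ 2) ∂gaussianReal 0 1 = (√(1 - 2 * t))⁻¹ := by
  rw [integral_gaussianReal_eq_integral_smul one_ne_zero]
  have h : ∀ x : ℝ, gaussianPDFReal 0 1 x • exp (t * x ^ 2)
      = (√(2 * π))⁻¹ * exp (-(1 / 2 - t) * x ^ 2) := fun x => by
    simp only [gaussianPDFReal_def, smul_eq_mul, mul_assoc, ← exp_add, NNReal.coe_one, mul_one]
    congr 2
    ring
  simp_rw [h]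
  rw [integral_const_mul, integral_gaussian, ← sqrt_inv, ← sqrt_inv, ← sqrt_mul (by positivity)]
  congr 1
  have : (1 / 2 - t) ≠ 0 := by linarith
  have : (1 - 2 * t) ≠ 0 := by linarith
  field_simp

variable {E : Type*} [NormedAddCommGroup E] [InnerProductSpace ℝ E] [FiniteDimensional ℝ E]
  [MeasurableSpace E] [BorelSpace E]

omit [FiniteDimensional ℝ E] [MeasurableSpace E] [BorelSpace E] in
theorem norm_sum_smul_orthonormalBasis_sq {ι : Type*} [Fintype ι] (b : OrthonormalBasis ι ℝ E)
    (x : ι → ℝ) : ‖∑ i, x i • b i‖ ^ 2 = ∑ i, x i ^ 2 := by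
  rw [← b.sum_sq_norm_inner_right]
  refine Finset.sum_congr rfl fun i _ => ?_
  classical
  simp [inner_sum, inner_smul_right, b.inner_eq_ite]

theorem integrable_exp_mul_norm_sq_stdGaussian {t : ℝ} (ht : t < 1 / 2) :
    Integrable (fun x : E => exp (t * ‖x‖ ^ 2)) (stdGaussian E) := by
  rw [stdGaussian, integrable_map_measure (by fun_prop) (Measurable.aemeasurable (by fun_prop))]
  simp only [Function.comp_def, norm_sum_smul_orthonormalBasis_sq, Finset.mul_sum, exp_sum]
  exact Integrable.fintype_prod fun _ => integrable_exp_mul_sq_gaussianReal ht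

theorem integral_exp_mul_norm_sq_stdGaussian {t : ℝ} (ht : t < 1 / 2) :
    ∫ x, exp (t * ‖x‖ ^ 2) ∂stdGaussian E = (√(1 - 2 * t))⁻¹ ^ Module.finrank ℝ E := by
  rw [stdGaussian, integral_map (Measurable.aemeasurable (by fun_prop)) (by fun_prop)]
  simp only [norm_sum_smul_orthonormalBasis_sq, Finset.mul_sum, exp_sum]
  rw [integral_fintype_prod_eq_prod (f := fun _ x => exp (t * x ^ 2))]
  simp [integral_exp_mul_sq_gaussianReal ht]

theorem pi_gaussianReal_sum_sq_eq (n : ℕ) (t : ℝ) :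
    Measure.pi (fun _ : Fin (n + 1) => gaussianReal 0 1) {x | ∑ i, x i ^ 2 = t} = 0 := by
  have hm : MeasurableSet {x : Fin (n + 1) → ℝ | ∑ i, x i ^ 2 = t} :=
    measurableSet_eq_fun (by fun_prop) (by fun_prop)
  have e := (measurePreserving_piFinSuccAbove (fun _ : Fin (n + 1) => gaussianReal 0 1) 0).symm
  rw [← e.measure_preimage hm.nullMeasurableSet, Measure.prod_apply_symm (e.measurable hm)]
  refine (lintegral_congr fun y => ?_).trans lintegral_zero
  have := nullSingletonClass_gaussianReal (μ := 0) (one_ne_zero (α := NNReal))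
  refine (Set.Finite.subset (Set.toFinite {√(t - ∑ i, y i ^ 2), -√(t - ∑ i, y i ^ 2)})
    fun x hx => ?_).measure_zero _
  have h : x ^ 2 + ∑ i, y i ^ 2 = t := by
    simpa [MeasurableEquiv.piFinSuccAbove, Fin.sum_univ_succ] using hx
  have h2 : √(t - ∑ i, y i ^ 2) = |x| := by rw [← sqrt_sq_eq_abs]; congr 1; linarith
  rw [h2]
  rcases abs_choice x with h | h <;> simp [h]

theorem stdGaussian_norm_sq_eq [Nontrivial E] (t : ℝ) : stdGaussian E {x | ‖x‖ ^ 2 = t} = 0 := by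
  have hm : MeasurableSet {x : E | ‖x‖ ^ 2 = t} :=
    measurableSet_eq_fun (by fun_prop) (by fun_prop)
  obtain ⟨n, hn⟩ : ∃ n, Module.finrank ℝ E = n + 1 :=
    ⟨_, (Nat.succ_pred_eq_of_pos Module.finrank_pos).symm⟩
  rw [stdGaussian_eq_map_pi_orthonormalBasis ((stdOrthonormalBasis ℝ E).reindex (finCongr hn)),
    Measure.map_apply (by fun_prop) hm]
  simpa only [Set.preimage_ofPred_eq, norm_sum_smul_orthonormalBasis_sq] using
    pi_gaussianReal_sum_sq_eq n t

theorem map_orthogonalProjection_stdGaussian (U : Submodule ℝ E) :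
    (stdGaussian E).map U.orthogonalProjectionOnto = stdGaussian U := by
  apply Measure.ext_of_charFunDual
  ext L
  rw [charFunDual_map, charFunDual_stdGaussian, charFunDual_stdGaussian]
  have : ‖L.comp U.orthogonalProjectionOnto‖ = ‖L‖ := by
    apply le_antisymm
    · refine (L.opNorm_comp_le _).trans ?_
      exact mul_le_of_le_one_right (norm_nonneg _) U.orthogonalProjectionOnto_norm_le
    · refine L.opNorm_le_bound (norm_nonneg _) fun x => ?_
      have := (L.comp U.orthogonalProjectionOnto).le_opNorm (x : E)
      simpa using this
  rw [this]

theorem map_inner_stdGaussian (v : E) :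
    (stdGaussian E).map (fun x => inner ℝ v x) = gaussianReal 0 (‖v‖ ^ 2).toNNReal := by
  have h := (IsGaussian.map_eq_gaussianReal (μ := stdGaussian E) (innerSL ℝ v))
  have h2 := variance_dual_stdGaussian (innerSL ℝ v)
  rw [integral_strongDual_stdGaussian, h2, innerSL_apply_norm] at h
  exact h


theorem stdGaussian_le_inner (v : E) {w x : ℝ} (hw : 0 < w) (hv : ‖v‖ ^ 2 ≤ w) (hx : 0 ≤ x) :
    (stdGaussian E).real {z | x ≤ inner ℝ v z} ≤ exp (-(x ^ 2 / (2 * w))) := by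
  have hi : Integrable (fun z : E => exp (x / w * inner ℝ v z)) (stdGaussian E) := by
    have := integrable_exp_mul_gaussianReal (μ := 0) (v := (‖v‖ ^ 2).toNNReal) (x / w)
    rw [← map_inner_stdGaussian, integrable_map_measure (by fun_prop) (by fun_prop)] at this
    exact this
  refine (measure_ge_le_exp_mul_mgf x (t := x / w) (by positivity) hi).trans ?_
  rw [mgf_gaussianReal (map_inner_stdGaussian v), ← exp_add, exp_le_exp,
    Real.coe_toNNReal _ (by positivity)]
  have : ‖v‖ ^ 2 * (x / w) ^ 2 / 2 ≤ w * (x / w) ^ 2 / 2 := by gcongr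
  have e : w * (x / w) ^ 2 / 2 = x ^ 2 / (2 * w) := by field_simp
  have e2 : -(x / w) * x = -(2 * (x ^ 2 / (2 * w))) := by field_simp
  linarith

variable {Ω : Type*} [MeasurableSpace Ω] {μ : Measure Ω} {Z : Ω → E}

theorem measure_le_abs_inner_le (hZ : HasLaw Z (stdGaussian E) μ) (v : E) {w x : ℝ} (hw : 0 < w)
    (hv : ‖v‖ ^ 2 ≤ w) (hx : 0 ≤ x) :
    μ {ω | x ≤ |inner ℝ v (Z ω)|} ≤ ENNReal.ofReal (2 * exp (-(x ^ 2 / (2 * w)))) := by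
  have h1 := stdGaussian_le_inner v hw hv hx
  have h2 := stdGaussian_le_inner (-v) hw (by rwa [norm_neg]) hx
  rw [hZ.measure_eq (p := fun z => x ≤ |inner ℝ v z|)
    (measurableSet_le (by fun_prop) (by fun_prop)), ← ofReal_measureReal]
  refine ENNReal.ofReal_le_ofReal ?_
  calc _ ≤ (stdGaussian E).real ({z | x ≤ inner ℝ v z} ∪ {z | x ≤ inner ℝ (-v) z}) := by
        refine measureReal_mono fun z hz => ?_
        simpa [le_abs, inner_neg_left] using hz
    _ ≤ _ := (measureReal_union_le _ _).trans (by linarith)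

theorem hasLaw_orthogonalProjection_stdGaussian (hZ : HasLaw Z (stdGaussian E) μ)
    (U : Submodule ℝ E) :
    HasLaw (fun ω => U.orthogonalProjectionOnto (Z ω)) (stdGaussian U) μ where
  aemeasurable := by have := hZ.aemeasurable; fun_prop
  map_eq := by
    rw [← map_orthogonalProjection_stdGaussian, ← hZ.map_eq,
      AEMeasurable.map_map_of_aemeasurable (by fun_prop) hZ.aemeasurable]
    rfl

/-- The law of `‖P_U Z‖²` is that of the squared norm of a standard Gaussian vector of `U`. -/
theorem measure_norm_starProjection_sq (hZ : HasLaw Z (stdGaussian E) μ) (U : Submodule ℝ E)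
    {p : ℝ → Prop} (hp : MeasurableSet {y | p y}) :
    μ {ω | p (‖U.starProjection (Z ω)‖ ^ 2)} = stdGaussian U {z | p (‖z‖ ^ 2)} :=
  (hasLaw_orthogonalProjection_stdGaussian hZ U).measure_eq (p := fun z => p (‖z‖ ^ 2))
    (measurableSet_preimage (f := fun z : U => ‖z‖ ^ 2) (by fun_prop) hp)

theorem measure_norm_starProjection_sq_eq (hZ : HasLaw Z (stdGaussian E) μ) (U : Submodule ℝ E)
    (hU : 0 < Module.finrank ℝ U) (t : ℝ) :
    μ {ω | ‖U.starProjection (Z ω)‖ ^ 2 = t} = 0 := by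
  have := Module.nontrivial_of_finrank_pos hU
  rw [measure_norm_starProjection_sq hZ U (p := fun y => y = t) (measurableSet_singleton t)]
  exact stdGaussian_norm_sq_eq t

theorem stdGaussian_le_norm_sq (y : ℝ) :
    (stdGaussian E).real {z | y ≤ ‖z‖ ^ 2} ≤ exp ((Module.finrank ℝ E : ℝ) / 2 - y / 4) := by
  refine (measure_ge_le_exp_mul_mgf y (t := 1 / 4) (by norm_num)
    (integrable_exp_mul_norm_sq_stdGaussian (by norm_num))).trans ?_
  rw [mgf, integral_exp_mul_norm_sq_stdGaussian (by norm_num),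
    show (Module.finrank ℝ E : ℝ) / 2 - y / 4 = -(1 / 4) * y + Module.finrank ℝ E / 2 by ring,
    exp_add]
  refine mul_le_mul le_rfl ?_ (by positivity) (by positivity)
  rw [show ((Module.finrank ℝ E : ℝ) / 2) = Module.finrank ℝ E * (1 / 2) by ring, exp_nat_mul]
  gcongr
  rw [exp_half, ← sqrt_inv]
  apply sqrt_le_sqrt
  have := add_one_le_exp (1 : ℝ)
  norm_num at this ⊢
  exact this

theorem measure_le_norm_starProjection_sq_le (hZ : HasLaw Z (stdGaussian E) μ) (U : Submodule ℝ E)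
    (y : ℝ) : μ {ω | y ≤ ‖U.starProjection (Z ω)‖ ^ 2}
      ≤ ENNReal.ofReal (exp ((Module.finrank ℝ U : ℝ) / 2 - y / 4)) := by
  rw [measure_norm_starProjection_sq hZ U (p := fun x => y ≤ x) measurableSet_Ici,
    ← ofReal_measureReal]
  exact ENNReal.ofReal_le_ofReal (stdGaussian_le_norm_sq y)

theorem inv_sqrt_one_sub_le {u : ℝ} (hu : |u| ≤ 1 / 2) :
    (√(1 - u))⁻¹ ≤ exp ((u + u ^ 2 / 2 + 2 * |u| ^ 3) / 2) := by
  have h := abs_log_sub_add_sum_range_le (x := u) (by linarith) 2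
  have h1 : |u| ^ 3 / (1 - |u|) ≤ 2 * |u| ^ 3 := by
    rw [div_le_iff₀ (by linarith)]
    nlinarith [pow_nonneg (abs_nonneg u) 3]
  have hpos : 0 < 1 - u := by linarith [le_abs_self u]
  simp only [Finset.sum_range_succ, Finset.sum_range_zero] at h
  norm_num at h
  have h2 := neg_le_of_abs_le h
  rw [← exp_log (inv_pos.mpr (sqrt_pos.mpr hpos)), exp_le_exp, log_inv, log_sqrt hpos.le]
  linarith

theorem chernoff_exponent_le {m : ℕ} {x u : ℝ} (hm : 0 < m) (hxm : x ≤ m / 2)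
    (hu : |u| = x / m) :
    exp (-|u| * x / 2 - u * m / 2) * (√(1 - u))⁻¹ ^ m
      ≤ exp (-(x ^ 2 / (4 * m) * (1 - 4 * x / m))) := by
  have hm' : (0 : ℝ) < m := by exact_mod_cast hm
  have h : |u| ≤ 1 / 2 := by rw [hu, div_le_iff₀ hm']; linarith
  calc _ ≤ exp (-|u| * x / 2 - u * m / 2) * exp ((u + u ^ 2 / 2 + 2 * |u| ^ 3) / 2) ^ m := by
        gcongr; exact inv_sqrt_one_sub_le h
    _ = _ := by
        rw [← exp_nat_mul, ← exp_add, ← sq_abs u, hu]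
        congr 1
        field_simp
        ring

theorem stdGaussian_le_abs_norm_sq_sub {x : ℝ} (hE : 0 < Module.finrank ℝ E) (hx : 0 ≤ x)
    (hxm : x ≤ (Module.finrank ℝ E : ℝ) / 2) :
    (stdGaussian E).real {z | x ≤ |‖z‖ ^ 2 - Module.finrank ℝ E|}
      ≤ 2 * exp (-(x ^ 2 / (4 * Module.finrank ℝ E) * (1 - 4 * x / Module.finrank ℝ E))) := by
  set m := Module.finrank ℝ E
  have hm' : (0 : ℝ) < m := by exact_mod_cast hE
  have hu0 : 0 ≤ x / m := by positivity
  have hu1 : x / m ≤ 1 / 2 := by rw [div_le_iff₀ hm']; linarith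
  have h1 : (stdGaussian E).real {z | m + x ≤ ‖z‖ ^ 2}
      ≤ exp (-(x ^ 2 / (4 * m) * (1 - 4 * x / m))) := by
    refine (measure_ge_le_exp_mul_mgf _ (t := x / m / 2) (by positivity)
      (integrable_exp_mul_norm_sq_stdGaussian (by linarith))).trans ?_
    rw [mgf, integral_exp_mul_norm_sq_stdGaussian (by linarith)]
    convert! chernoff_exponent_le hE hxm (u := x / m) (abs_of_nonneg hu0) using 3
    · rw [abs_of_nonneg hu0]; ring
    · ring_nf
  have h2 : (stdGaussian E).real {z | ‖z‖ ^ 2 ≤ m - x}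
      ≤ exp (-(x ^ 2 / (4 * m) * (1 - 4 * x / m))) := by
    refine (measure_le_le_exp_mul_mgf _ (t := -(x / m) / 2) (by linarith)
      (integrable_exp_mul_norm_sq_stdGaussian (by linarith))).trans ?_
    rw [mgf, integral_exp_mul_norm_sq_stdGaussian (by linarith)]
    have hu : |-(x / m)| = x / m := by rw [abs_neg, abs_of_nonneg hu0]
    convert! chernoff_exponent_le hE hxm (u := -(x / m)) hu using 3
    · rw [hu]; ring
    · ring_nf
  calc _ ≤ (stdGaussian E).real ({z | m + x ≤ ‖z‖ ^ 2} ∪ {z | ‖z‖ ^ 2 ≤ m - x}) := by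
        refine measureReal_mono fun z hz => ?_
        rcases le_abs.mp (Set.mem_ofPred_eq ▸ hz) with h | h
        · exact Or.inl (by simp only [Set.mem_ofPred_eq]; linarith)
        · exact Or.inr (by simp only [Set.mem_ofPred_eq]; linarith)
    _ ≤ _ := (measureReal_union_le _ _).trans (by linarith)

theorem measure_le_abs_norm_starProjection_sq_sub_le (hZ : HasLaw Z (stdGaussian E) μ)
    (U : Submodule ℝ E) {m : ℕ} (hm : Module.finrank ℝ U = m) {x : ℝ} (hm0 : 0 < m) (hx : 0 ≤ x)
    (hxm : x ≤ (m : ℝ) / 2) :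
    μ {ω | x ≤ |‖U.starProjection (Z ω)‖ ^ 2 - m|}
      ≤ ENNReal.ofReal (2 * exp (-(x ^ 2 / (4 * m) * (1 - 4 * x / m)))) := by
  subst hm
  rw [measure_norm_starProjection_sq hZ U (p := fun y => x ≤ |y - Module.finrank ℝ U|)
    (measurableSet_le (by fun_prop) (by fun_prop)), ← ofReal_measureReal]
  exact ENNReal.ofReal_le_ofReal (stdGaussian_le_abs_norm_sq_sub hm0 hx hxm)

end StdGaussian

theorem Submodule.starProjection_orthogonal_inf {E : Type*} [NormedAddCommGroup E]
    [InnerProductSpace ℝ E] [FiniteDimensional ℝ E] {U V : Submodule ℝ E} (h : U ≤ V) (x : E) :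
    (Uᗮ ⊓ V).starProjection x = V.starProjection x - U.starProjection x := by
  refine Submodule.eq_starProjection_of_mem_orthogonal'
    (z := (x - V.starProjection x) + U.starProjection x) ⟨?_, ?_⟩ ?_ (by abel)
  · rw [← Submodule.starProjection_comp_starProjection_of_le h]
    exact Submodule.sub_starProjection_mem_orthogonal _
  · exact sub_mem (Submodule.starProjection_apply_mem _ _)
      (h (Submodule.starProjection_apply_mem _ _))
  · refine add_mem (Submodule.orthogonal_le inf_le_right
      (Submodule.sub_starProjection_mem_orthogonal x)) ?_
    exact Submodule.orthogonal_le inf_le_left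
      (Submodule.le_orthogonal_orthogonal _ (Submodule.starProjection_apply_mem _ _))

namespace RegressionSetup

variable {Ω : Type*} [MeasurableSpace Ω] {μ : Measure Ω} {X : Type*} {Γ : ℕ → Type*}
variable (S : RegressionSetup μ X Γ)

/-- The error vector divided by the noise level. -/
def noise (n : ℕ) (ω : Ω) : EuclideanSpace ℝ (Fin n) :=
  WithLp.toLp 2 (fun i => S.ε n i ω / S.σ)

theorem hasLaw_noise (n : ℕ) :
    HasLaw (S.noise n) (stdGaussian (EuclideanSpace ℝ (Fin n))) μ := by
  have h1 : ∀ i, HasLaw (fun ω => S.ε n i ω / S.σ) (gaussianReal 0 1) μ := fun i => by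
    have := gaussianReal_div_const (S.ε_law n i) S.σ
    convert! this using 2
    · simp
    · ext
      simp [max_eq_left (sq_nonneg S.σ), S.σ_pos.ne']
  have h2 : iIndepFun (fun i ω => S.ε n i ω / S.σ) μ :=
    (S.ε_indep n).comp (fun _ y => y / S.σ) fun _ => by fun_prop
  have h3 : MeasurePreserving (WithLp.toLp 2) (Measure.pi fun _ : Fin n => gaussianReal 0 1)
    (stdGaussian (EuclideanSpace ℝ (Fin n))) := ⟨by fun_prop, map_pi_eq_stdGaussian⟩
  exact h3.comp_hasLaw (h2.hasLaw_pi h1)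

theorem response_eq (n : ℕ) (ω : Ω) : S.response n ω = S.mean n + S.σ • S.noise n ω := by
  rw [response, noise, ← WithLp.toLp_smul]
  congr 2
  ext i
  simp [mul_div_cancel₀ _ S.σ_pos.ne']

variable {S} in
theorem colSpace_le_of_mem_subModels {n : ℕ} {k s : Γ n} (hs : s ∈ S.subModels n k) :
    S.colSpace n s ≤ S.colSpace n k := Submodule.map_mono hs.1

/-- The orthogonal complement of the column space of `s` in that of `k`. -/
def diffSpace (n : ℕ) (k s : Γ n) : Submodule ℝ (EuclideanSpace ℝ (Fin n)) :=
  (S.colSpace n s)ᗮ ⊓ S.colSpace n k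

variable {S} in
theorem finrank_diffSpace {n : ℕ} {k s : Γ n} (hs : s ∈ S.subModels n k) :
    Module.finrank ℝ (S.diffSpace n k s) = 1 := by
  have h := Submodule.finrank_add_inf_finrank_orthogonal (colSpace_le_of_mem_subModels hs)
  exact Nat.add_left_cancel (h.trans hs.2.symm)

variable {S} in
theorem starProjection_diffSpace {n : ℕ} {k s : Γ n} (hs : s ∈ S.subModels n k)
    (x : EuclideanSpace ℝ (Fin n)) :
    (S.diffSpace n k s).starProjection x = S.proj n k x - S.proj n s x :=
  Submodule.starProjection_orthogonal_inf (colSpace_le_of_mem_subModels hs) x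

theorem rank_le (n : ℕ) (k : Γ n) : S.rank n k ≤ n := by
  exact (Submodule.finrank_le (S.colSpace n k)).trans_eq finrank_euclideanSpace_fin

theorem finrank_orthogonal_colSpace (n : ℕ) (k : Γ n) :
    Module.finrank ℝ (S.colSpace n k)ᗮ = n - S.rank n k := by
  have := Submodule.finrank_add_finrank_orthogonal (S.colSpace n k)
  simp only [finrank_euclideanSpace_fin] at this
  simp only [rank]
  omega

variable {S} in
theorem RSS_sub_RSS {n : ℕ} {k s : Γ n} (hs : s ∈ S.subModels n k) (ω : Ω) :
    S.RSS n s ω = S.RSS n k ω + ‖(S.diffSpace n k s).starProjection (S.response n ω)‖ ^ 2 := by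
  rw [starProjection_diffSpace hs, RSS, RSS]
  set y := S.response n ω
  have h : inner ℝ (y - S.proj n k y) (S.proj n k y - S.proj n s y) = 0 :=
    Submodule.starProjection_inner_eq_zero _ _ (sub_mem (Submodule.starProjection_apply_mem _ _)
      (colSpace_le_of_mem_subModels hs (Submodule.starProjection_apply_mem _ _)))
  have h2 : y - S.proj n s y = (y - S.proj n k y) + (S.proj n k y - S.proj n s y) := by abel
  rw [h2, norm_add_sq_real, h]
  ring

variable {S} in
theorem IC_subModel {n : ℕ} {k s : Γ n} (hs : s ∈ S.subModels n k) (ω : Ω) :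
    S.IC n s ω = S.IC n k ω + ‖(S.diffSpace n k s).starProjection (S.response n ω)‖ ^ 2
      - S.lam n * Real.log n * S.σ ^ 2 := by
  have h : (S.rank n k : ℝ) = S.rank n s + 1 := by exact_mod_cast hs.2.symm
  rw [IC, IC, RSS_sub_RSS hs, h]
  ring

theorem norm_starProjection_response_sq_le (n : ℕ) (ω : Ω)
    (U : Submodule ℝ (EuclideanSpace ℝ (Fin n))) :
    ‖U.starProjection (S.response n ω)‖ ^ 2
      ≤ 2 * ‖U.starProjection (S.mean n)‖ ^ 2
        + 2 * S.σ ^ 2 * ‖U.starProjection (S.noise n ω)‖ ^ 2 := by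
  rw [response_eq, map_add, map_smul]
  have h := norm_add_le (U.starProjection (S.mean n)) (S.σ • U.starProjection (S.noise n ω))
  rw [norm_smul, Real.norm_of_nonneg S.σ_pos.le] at h
  calc _ ≤ (‖U.starProjection (S.mean n)‖ + S.σ * ‖U.starProjection (S.noise n ω)‖) ^ 2 := by
        gcongr
    _ ≤ _ := by
        nlinarith [sq_nonneg
          (‖U.starProjection (S.mean n)‖ - S.σ * ‖U.starProjection (S.noise n ω)‖)]

theorem le_norm_starProjection_response_sq (n : ℕ) (ω : Ω)
    (U : Submodule ℝ (EuclideanSpace ℝ (Fin n))) :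
    ‖U.starProjection (S.mean n)‖ ^ 2 / 2 - S.σ ^ 2 * ‖U.starProjection (S.noise n ω)‖ ^ 2
      ≤ ‖U.starProjection (S.response n ω)‖ ^ 2 := by
  have h : ‖U.starProjection (S.mean n)‖
      ≤ ‖U.starProjection (S.response n ω)‖ + S.σ * ‖U.starProjection (S.noise n ω)‖ := by
    rw [response_eq, map_add, map_smul, ← Real.norm_of_nonneg S.σ_pos.le, ← norm_smul,
      Real.norm_of_nonneg S.σ_pos.le]
    simpa using norm_sub_le
      (U.starProjection (S.mean n) + S.σ • U.starProjection (S.noise n ω))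
      (S.σ • U.starProjection (S.noise n ω))
  have h2 : ‖U.starProjection (S.mean n)‖ ^ 2 ≤ (‖U.starProjection (S.response n ω)‖
      + S.σ * ‖U.starProjection (S.noise n ω)‖) ^ 2 := by gcongr
  nlinarith [sq_nonneg
    (‖U.starProjection (S.response n ω)‖ - S.σ * ‖U.starProjection (S.noise n ω)‖)]

/-- The approximation error vector divided by the noise level. -/
def scaledBias (n : ℕ) (k : Γ n) : EuclideanSpace ℝ (Fin n) :=
  S.σ⁻¹ • (S.mean n - S.proj n k (S.mean n))

theorem norm_scaledBias_sq (n : ℕ) (k : Γ n) :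
    ‖S.scaledBias n k‖ ^ 2 = S.approxErr n k / S.σ ^ 2 := by
  rw [scaledBias, norm_smul, mul_pow, approxErr]
  simp
  ring

theorem RSS_eq (n : ℕ) (k : Γ n) (ω : Ω) :
    S.RSS n k ω = S.σ ^ 2 * (S.approxErr n k / S.σ ^ 2
      + 2 * inner ℝ (S.scaledBias n k) (S.noise n ω)
      + ‖(S.colSpace n k)ᗮ.starProjection (S.noise n ω)‖ ^ 2) := by
  have hσ := S.σ_pos.ne'
  have h : S.response n ω - S.proj n k (S.response n ω)
      = S.σ • (S.scaledBias n k + (S.colSpace n k)ᗮ.starProjection (S.noise n ω)) := by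
    rw [Submodule.starProjection_orthogonal_val, scaledBias, smul_add, smul_inv_smul₀ hσ,
      response_eq, map_add, map_smul, smul_sub, proj]
    abel
  have h2 : inner ℝ (S.scaledBias n k) ((S.colSpace n k)ᗮ.starProjection (S.noise n ω))
      = inner ℝ (S.scaledBias n k) (S.noise n ω) := by
    rw [← Submodule.inner_starProjection_left_eq_right, Submodule.starProjection_eq_self_iff.mpr]
    exact Submodule.smul_mem _ _ (Submodule.sub_starProjection_mem_orthogonal _)
  rw [RSS, h, norm_smul, mul_pow, norm_add_sq_real, h2, norm_scaledBias_sq]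
  simp

theorem IC_eq (n : ℕ) (k : Γ n) (ω : Ω) :
    S.IC n k ω = S.σ ^ 2 * (S.size n k + 2 * inner ℝ (S.scaledBias n k) (S.noise n ω)
      + (‖(S.colSpace n k)ᗮ.starProjection (S.noise n ω)‖ ^ 2 - (n - S.rank n k : ℕ))) := by
  rw [IC, RSS_eq, size, Nat.cast_sub (S.rank_le n k)]
  ring

theorem one_le_lam_mul_log {n : ℕ} (hn : 2 ≤ n) : 1 ≤ S.lam n * Real.log n := by
  have h : 0 < Real.log n := Real.log_pos (by exact_mod_cast hn)
  have := mul_le_mul_of_nonneg_right (S.lam_ge n hn) h.le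
  rwa [inv_mul_cancel₀ h.ne'] at this

theorem approxErr_nonneg (n : ℕ) (k : Γ n) : 0 ≤ S.approxErr n k := sq_nonneg _

theorem penalty_nonneg (n : ℕ) : 0 ≤ S.d * Real.sqrt n * Real.log n :=
  mul_nonneg (mul_nonneg S.d_nonneg (Real.sqrt_nonneg _)) (Real.log_natCast_nonneg n)

theorem norm_scaledBias_sq_le_size {n : ℕ} (hn : 2 ≤ n) (k : Γ n) :
    ‖S.scaledBias n k‖ ^ 2 ≤ S.size n k := by
  rw [norm_scaledBias_sq, size]
  have := mul_nonneg (sub_nonneg.mpr (S.one_le_lam_mul_log hn)) (S.rank n k).cast_nonneg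
  linarith [S.penalty_nonneg n]

theorem lam_mul_rank_le_size (n : ℕ) (k : Γ n) :
    (S.lam n * Real.log n - 1) * S.rank n k ≤ S.size n k := by
  have := S.penalty_nonneg n
  have := div_nonneg (S.approxErr_nonneg n k) (sq_nonneg S.σ)
  rw [size]
  linarith

theorem B_rank_le_size {n : ℕ} (hn : 2 ≤ n) (k : Γ n) : S.B n (S.rank n k) ≤ S.size n k :=
  ciInf_le (f := fun k' : {k' : Γ n // S.rank n k' = S.rank n k} => S.size n k')
    ⟨0, by rintro _ ⟨k', rfl⟩; exact (sq_nonneg _).trans (S.norm_scaledBias_sq_le_size hn k')⟩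
    ⟨k, rfl⟩

theorem B_nonneg {n : ℕ} (hn : 2 ≤ n) (j : ℕ) : 0 ≤ S.B n j :=
  Real.iInf_nonneg fun k => (sq_nonneg _).trans (S.norm_scaledBias_sq_le_size hn k)

/-! ### The nonparametric scenario -/

theorem measure_le_abs_two_mul_inner_scaledBias_le {n : ℕ} (hn : 2 ≤ n) (k : Γ n) {η B : ℝ}
    (hη : 0 ≤ η) (hB : 0 < B) (hBk : B ≤ S.size n k) :
    μ {ω | η * S.size n k ≤ |2 * inner ℝ (S.scaledBias n k) (S.noise n ω)|}
      ≤ ENNReal.ofReal (2 * Real.exp (-(η ^ 2 / 8 * B))) := by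
  have hD : 0 < S.size n k := hB.trans_le hBk
  have h := measure_le_abs_inner_le (S.hasLaw_noise n) (S.scaledBias n k) hD
    (S.norm_scaledBias_sq_le_size hn k) (x := η * S.size n k / 2) (by positivity)
  refine (measure_mono fun ω hω => ?_).trans (h.trans (ENNReal.ofReal_le_ofReal ?_))
  · simp only [Set.mem_ofPred_eq, abs_mul, abs_two] at hω ⊢
    linarith
  · gcongr
    rw [show (η * S.size n k / 2) ^ 2 / (2 * S.size n k) = η ^ 2 / 8 * S.size n k by
      field_simp; ring]
    gcongr

theorem measure_le_norm_starProjection_diffSpace_le {n : ℕ} {k s : Γ n}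
    (hs : s ∈ S.subModels n k) {η B : ℝ} (hη : 0 ≤ η) (hBk : B ≤ S.size n k) :
    μ {ω | η * S.size n k ≤ ‖(S.diffSpace n k s).starProjection (S.noise n ω)‖ ^ 2}
      ≤ ENNReal.ofReal (2 * Real.exp (-(η / 4 * B))) := by
  refine (measure_le_norm_starProjection_sq_le (S.hasLaw_noise n) _ _).trans
    (ENNReal.ofReal_le_ofReal ?_)
  rw [finrank_diffSpace hs, sub_eq_add_neg, Real.exp_add]
  have h : Real.exp ((1 : ℕ) / 2) ≤ 2 := by
    have h1 := Real.exp_one_lt_d9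
    have h2 : Real.exp ((1 : ℕ) / 2) ^ 2 = Real.exp 1 := by
      rw [← Real.exp_nat_mul]; norm_num
    nlinarith [Real.exp_pos ((1 : ℕ) / 2)]
  have h3 : η / 4 * B ≤ η * S.size n k / 4 := by nlinarith
  gcongr

theorem measure_le_abs_norm_starProjection_orthogonal_sub_le {n : ℕ} {k : Γ n} {B : ℝ}
    (hk : S.rank n k < n) (hB : 0 < B) (hBk : B ≤ S.size n k)
    (hBm : B ≤ 1 / 50 * ((n - S.rank n k : ℕ) : ℝ)) :
    μ {ω | 19 / 20 * S.size n k
      ≤ |‖(S.colSpace n k)ᗮ.starProjection (S.noise n ω)‖ ^ 2 - (n - S.rank n k : ℕ)|}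
      ≤ ENNReal.ofReal (2 * Real.exp (-(B ^ 2 / (5 * (n - S.rank n k : ℕ))))) := by
  set m := n - S.rank n k with hm
  have hm0 : 0 < m := by omega
  have hm' : (0 : ℝ) < m := by exact_mod_cast hm0
  have h := measure_le_abs_norm_starProjection_sq_sub_le (S.hasLaw_noise n) _
    (S.finrank_orthogonal_colSpace n k) (x := 19 / 20 * B) hm0 (by positivity) (by linarith)
  refine (measure_mono fun ω hω => ?_).trans (h.trans (ENNReal.ofReal_le_ofReal ?_))
  · simp only [Set.mem_ofPred_eq] at hω ⊢
    refine le_trans ?_ hω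
    gcongr
  · gcongr
    have h1 : B / m ≤ 1 / 50 := by rwa [div_le_iff₀ hm']
    have h2 : 0 ≤ B ^ 2 / m := by positivity
    calc B ^ 2 / (5 * m) = B ^ 2 / m * (1 / 5) := by field_simp
      _ ≤ B ^ 2 / m * ((19 / 20) ^ 2 / 4 * (1 - 4 * (19 / 20) * (B / m))) := by
          gcongr; linarith
      _ = _ := by rw [← hm]; field_simp

variable {S} in
theorem abs_IC_div_IC_sub_one_le {n : ℕ} {k s : Γ n} (hs : s ∈ S.subModels n k) {η : ℝ} {ω : Ω}
    (hη : η ≤ 3 / 100) (hD : 0 < S.size n k)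
    (h1 : |2 * inner ℝ (S.scaledBias n k) (S.noise n ω)| < η * S.size n k)
    (h2 : |‖(S.colSpace n k)ᗮ.starProjection (S.noise n ω)‖ ^ 2 - (n - S.rank n k : ℕ)|
      < 19 / 20 * S.size n k)
    (h3 : ‖(S.diffSpace n k s).starProjection (S.noise n ω)‖ ^ 2 < η * S.size n k)
    (h4 : ‖(S.diffSpace n k s).starProjection (S.mean n)‖ ^ 2 ≤ η * S.σ ^ 2 * S.size n k)
    (h5 : 0 ≤ S.lam n * Real.log n) (h6 : S.lam n * Real.log n ≤ 4 * η * S.size n k) :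
    |S.IC n s ω / S.IC n k ω - 1| ≤ 200 * η := by
  have hσ : 0 < S.σ ^ 2 := pow_pos S.σ_pos 2
  have hIC : S.σ ^ 2 * (S.size n k / 50) ≤ S.IC n k ω := by
    rw [IC_eq]
    gcongr
    nlinarith [(abs_lt.mp h1).1, (abs_lt.mp h2).1]
  have hpos : 0 < S.IC n k ω := lt_of_lt_of_le (by positivity) hIC
  have hη0 : 0 ≤ η := by
    by_contra! h
    nlinarith [abs_nonneg (2 * inner ℝ (S.scaledBias n k) (S.noise n ω))]
  rw [div_sub_one hpos.ne', abs_div, abs_of_pos hpos, div_le_iff₀ hpos, IC_subModel hs]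
  have h7 := S.norm_starProjection_response_sq_le n ω (S.diffSpace n k s)
  have h8 := sq_nonneg ‖(S.diffSpace n k s).starProjection (S.response n ω)‖
  have h9 : S.lam n * Real.log n * S.σ ^ 2 ≤ 4 * η * S.size n k * S.σ ^ 2 := by gcongr
  have h10 := mul_nonneg h5 hσ.le
  have h11 : S.σ ^ 2 * ‖(S.diffSpace n k s).starProjection (S.noise n ω)‖ ^ 2
      ≤ S.σ ^ 2 * (η * S.size n k) := by gcongr
  have h12 : 200 * η * (S.σ ^ 2 * (S.size n k / 50)) ≤ 200 * η * S.IC n k ω := by gcongr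
  rw [abs_le]
  constructor <;> linarith

theorem PI_lt {n : ℕ} {khat : Ω → Γ n} {ω : Ω} {c : ℝ} {s : Γ n}
    (hr : 1 < S.rank n (khat ω)) (hs : s ∈ S.subModels n (khat ω))
    (h : |S.IC n s ω / S.IC n (khat ω) ω| < c) : S.PI n khat ω < c := by
  rw [PI, if_pos hr]
  exact (ciInf_le (f := fun k : S.subModels n (khat ω) => |S.IC n k ω / S.IC n (khat ω) ω|)
    ⟨0, by rintro _ ⟨k, rfl⟩; exact abs_nonneg _⟩ ⟨s, hs⟩).trans_lt h

theorem signedPI_lt {n : ℕ} {khat : Ω → Γ n} {ω : Ω} {c : ℝ} {s : Γ n}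
    (hr : 1 < S.rank n (khat ω)) (hs : s ∈ S.subModels n (khat ω)) (hc : 0 < c)
    (h : S.IC n s ω / S.IC n (khat ω) ω < c) : S.signedPI n khat ω < c := by
  rw [signedPI, if_pos hr]
  by_cases hb : BddBelow (Set.range
      fun k : S.subModels n (khat ω) => S.IC n k ω / S.IC n (khat ω) ω)
  · exact (ciInf_le hb ⟨s, hs⟩).trans_lt h
  · rwa [Real.iInf_of_not_bddBelow hb]

theorem lam_mul_log_le_mul_size {n : ℕ} {k : Γ n} {η : ℝ} (hη : 0 < η)
    (hr : 1 / (2 * η) ≤ S.rank n k) (hD : 1 / (2 * η) ≤ S.size n k) :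
    S.lam n * Real.log n ≤ 4 * η * S.size n k := by
  have h := S.lam_mul_rank_le_size n k
  rw [div_le_iff₀ (by positivity)] at hr hD
  by_cases h2 : S.lam n * Real.log n ≤ 2
  · linarith
  · nlinarith

/-- Sum of a uniform bound over a countable family of models. -/
theorem _root_.MeasureTheory.measure_biUnion_le_encard_mul {α ι : Type*} [MeasurableSpace α]
    [Countable ι] (ν : Measure α) (T : Set ι) (F : ι → Set α) {p : ℝ≥0∞}
    (h : ∀ i ∈ T, ν (F i) ≤ p) : ν (⋃ i ∈ T, F i) ≤ (T.encard : ℝ≥0∞) * p := by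
  refine (measure_biUnion_le ν T.to_countable F).trans ?_
  rw [← ENNReal.tsum_set_const]
  exact ENNReal.tsum_le_tsum fun i => h i i.2

theorem N_le_of_N_mul_L_le (hsub : S.HasSubModels) {n j : ℕ} (hj : 1 < j) {p : ℝ≥0∞}
    (h : ((S.N n j * S.L n j : ℕ∞) : ℝ≥0∞) ≤ p) : (S.N n j : ℝ≥0∞) ≤ p := by
  by_cases h0 : S.N n j = 0
  · simp [h0]
  · obtain ⟨k, hk⟩ := Set.encard_ne_zero.mp h0
    have hk' : S.rank n k = j := hk
    have hL : 1 ≤ S.L n j :=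
      (Set.one_le_encard_iff_nonempty.mpr (hsub n k (hk'.symm ▸ hj))).trans
        (le_iSup (fun k : {k : Γ n // S.rank n k = j} => (S.subModels n k).encard) ⟨k, hk⟩)
    refine le_trans ?_ h
    exact_mod_cast le_mul_of_one_le_right (zero_le) hL

theorem mul_ofReal_exp_le {N : ℝ≥0∞} {c₀ x y z : ℝ} (hc : 0 ≤ c₀)
    (hN : N ≤ ENNReal.ofReal (c₀ * Real.exp x)) (h : x - y ≤ -z) :
    N * ENNReal.ofReal (2 * Real.exp (-y)) ≤ ENNReal.ofReal (2 * c₀ * Real.exp (-z)) := by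
  calc _ ≤ ENNReal.ofReal (c₀ * Real.exp x) * ENNReal.ofReal (2 * Real.exp (-y)) := by gcongr
    _ = ENNReal.ofReal (2 * c₀ * Real.exp (x - y)) := by
        rw [← ENNReal.ofReal_mul (by positivity), sub_eq_add_neg, Real.exp_add]
        ring_nf
    _ ≤ _ := by gcongr

variable {S} in
theorem exists_mem_subModels_norm_starProjection_le (hsub : S.HasSubModels) {n : ℕ} {k : Γ n}
    {η : ℝ} (hη : 0 < η) (hr : 1 < S.rank n k) (hD : 0 < S.size n k)
    (h : (⨅ s : S.subModels n k, ‖S.proj n k (S.mean n) - S.proj n s (S.mean n)‖ ^ 2)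
      / S.size n k ≤ η * S.σ ^ 2 / 2) :
    ∃ s ∈ S.subModels n k,
      ‖(S.diffSpace n k s).starProjection (S.mean n)‖ ^ 2 ≤ η * S.σ ^ 2 * S.size n k := by
  have := (hsub n k hr).to_subtype
  have hσ : 0 < S.σ ^ 2 := pow_pos S.σ_pos 2
  rw [div_le_iff₀ hD] at h
  have h2 : 0 < η * S.σ ^ 2 * S.size n k := by positivity
  obtain ⟨s, hs⟩ := exists_lt_of_ciInf_lt (h.trans_lt
    (by linarith : η * S.σ ^ 2 / 2 * S.size n k < η * S.σ ^ 2 * S.size n k))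
  exact ⟨s, s.2, by rw [starProjection_diffSpace s.2]; exact hs.le⟩

/-- The event that one of the noise terms in `IC(k)` and `IC(s) - IC(k)` is not small compared with
`size k`. -/
def deviationSet (n : ℕ) (η : ℝ) (k s : Γ n) : Set Ω :=
  {ω | η * S.size n k ≤ |2 * inner ℝ (S.scaledBias n k) (S.noise n ω)|} ∪
  {ω | 19 / 20 * S.size n k
    ≤ |‖(S.colSpace n k)ᗮ.starProjection (S.noise n ω)‖ ^ 2 - (n - S.rank n k : ℕ)|} ∪
  {ω | η * S.size n k ≤ ‖(S.diffSpace n k s).starProjection (S.noise n ω)‖ ^ 2}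

theorem measure_biUnion_rank_le (hsub : S.HasSubModels) {n j : ℕ} [Countable (Γ n)] {η c₀ ζ : ℝ}
    (hη : 0 < η) (hη1 : η ≤ 1) (hn : 2 ≤ n) (hj : 1 < j) (hjn : j < n) (hB : 0 < S.B n j)
    (hBm : S.B n j / ((n : ℝ) - j) ≤ min (1 / 50) (η ^ 2 / 2)) (hζ : ζ ≤ η ^ 2 / 16)
    (hc₀ : 0 ≤ c₀)
    (hN1 : ((S.N n j * S.L n j : ℕ∞) : ℝ≥0∞) ≤ ENNReal.ofReal (c₀ * Real.exp (ζ * S.B n j)))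
    (hN2 : (S.N n j : ℝ≥0∞)
      ≤ ENNReal.ofReal (c₀ * Real.exp (S.B n j ^ 2 / (10 * ((n : ℝ) - j)))))
    (s : Γ n → Γ n) (hs : ∀ k, S.rank n k = j → s k ∈ S.subModels n k) :
    μ (⋃ k ∈ {k : Γ n | S.rank n k = j}, S.deviationSet n η k (s k))
      ≤ ENNReal.ofReal (6 * c₀ * Real.exp (-(S.B n j ^ 2 / (10 * ((n : ℝ) - j))))) := by
  set B := S.B n j with hBdef
  have hm : ((n - j : ℕ) : ℝ) = (n : ℝ) - j := Nat.cast_sub hjn.le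
  have hm0 : (0 : ℝ) < (n : ℝ) - j := sub_pos.mpr (by exact_mod_cast hjn)
  have hBm1 : B ≤ 1 / 50 * ((n : ℝ) - j) :=
    (div_le_iff₀ hm0).mp (hBm.trans (min_le_left _ _))
  have hBm2 : B ^ 2 / (10 * ((n : ℝ) - j)) ≤ η ^ 2 / 20 * B := by
    have h := mul_le_mul_of_nonneg_left (hBm.trans (min_le_right _ _)) hB.le
    calc B ^ 2 / (10 * ((n : ℝ) - j)) = B * (B / ((n : ℝ) - j)) / 10 := by field_simp
      _ ≤ _ := by linarith
  have hζB : ζ * B ≤ η ^ 2 / 16 * B := by gcongr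
  have hηB : η ^ 2 * B ≤ η * B := by
    gcongr
    nlinarith
  have hN := S.N_le_of_N_mul_L_le hsub hj hN1
  have hη2 : 0 < η ^ 2 * B := by positivity
  refine (measure_biUnion_le_encard_mul μ _ _
    (p := ENNReal.ofReal (2 * Real.exp (-(η ^ 2 / 8 * B)))
      + ENNReal.ofReal (2 * Real.exp (-(B ^ 2 / (5 * ((n : ℝ) - j)))))
      + ENNReal.ofReal (2 * Real.exp (-(η / 4 * B)))) fun k hk => ?_).trans ?_
  · have hk : S.rank n k = j := hk
    have hBk : B ≤ S.size n k := by rw [hBdef, ← hk]; exact S.B_rank_le_size hn k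
    refine (measure_union_le _ _).trans (add_le_add ((measure_union_le _ _).trans
      (add_le_add ?_ ?_)) ?_)
    · exact S.measure_le_abs_two_mul_inner_scaledBias_le hn k hη.le hB hBk
    · have h := S.measure_le_abs_norm_starProjection_orthogonal_sub_le (k := k) (hk ▸ hjn) hB hBk
        (by rw [hk, hm]; exact hBm1)
      rw [hk, hm] at h
      rwa [hk, hm]
    · exact S.measure_le_norm_starProjection_diffSpace_le (hs k hk) hη.le hBk
  · set z := B ^ 2 / (10 * ((n : ℝ) - j)) with hz
    have hz2 : B ^ 2 / (5 * ((n : ℝ) - j)) = 2 * z := by rw [hz]; field_simp; norm_num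
    have e1 := mul_ofReal_exp_le (y := η ^ 2 / 8 * B) (z := z) hc₀ hN (by linarith)
    have e2 := mul_ofReal_exp_le (y := B ^ 2 / (5 * ((n : ℝ) - j))) (z := z) hc₀ hN2 (by linarith)
    have e3 := mul_ofReal_exp_le (y := η / 4 * B) (z := z) hc₀ hN (by linarith)
    rw [mul_add, mul_add]
    refine (add_le_add (add_le_add e1 e2) e3).trans_eq ?_
    rw [← ENNReal.ofReal_add (by positivity) (by positivity),
      ← ENNReal.ofReal_add (by positivity) (by positivity)]
    ring_nf

theorem measure_not_index_lt_le (hsub : S.HasSubModels) {n a b : ℕ} [Countable (Γ n)]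
    {c η c₀ ζ : ℝ} (khat : Ω → Γ n) (hη : 0 < η) (hη1 : η ≤ 3 / 100) (hηc : 200 * η < c - 1)
    (hn : 2 ≤ n) (ha : 2 ≤ a) (haη : 1 / (2 * η) ≤ a) (hbn : b < n) (hζ : ζ ≤ η ^ 2 / 16)
    (hc₀ : 0 ≤ c₀) (hB : ∀ j, a ≤ j → j ≤ b → 1 / (2 * η) ≤ S.B n j)
    (hBm : ∀ j, a ≤ j → j ≤ b → S.B n j / ((n : ℝ) - j) ≤ min (1 / 50) (η ^ 2 / 2))
    (hN : ∀ j, a ≤ j → j ≤ b →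
      ((S.N n j * S.L n j : ℕ∞) : ℝ≥0∞) ≤ ENNReal.ofReal (c₀ * Real.exp (ζ * S.B n j)) ∧
      (S.N n j : ℝ≥0∞) ≤
        ENNReal.ofReal (c₀ * Real.exp (S.B n j ^ 2 / (10 * ((n : ℝ) - j)))))
    (hN3 : ∀ k : Γ n, a ≤ S.rank n k → S.rank n k ≤ b →
      (⨅ s : S.subModels n k, ‖S.proj n k (S.mean n) - S.proj n s (S.mean n)‖ ^ 2) / S.size n k
        ≤ η * S.σ ^ 2 / 2) :
    μ {ω | ¬(S.PI n khat ω < c ∧ S.signedPI n khat ω < c)}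
      ≤ μ {ω | a ≤ S.rank n (khat ω) ∧ S.rank n (khat ω) ≤ b}ᶜ
        + ENNReal.ofReal (6 * c₀ * ∑ j ∈ Finset.Icc a b,
            Real.exp (-(S.B n j ^ 2 / (10 * ((n : ℝ) - j))))) := by
  have hη0 : 0 < 1 / (2 * η) := by positivity
  have hDk : ∀ k : Γ n, a ≤ S.rank n k → S.rank n k ≤ b → 1 / (2 * η) ≤ S.size n k :=
    fun k h1 h2 => (hB _ h1 h2).trans (S.B_rank_le_size hn k)
  have hex : ∀ k : Γ n, ∃ s, a ≤ S.rank n k → S.rank n k ≤ b → s ∈ S.subModels n k ∧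
      ‖(S.diffSpace n k s).starProjection (S.mean n)‖ ^ 2 ≤ η * S.σ ^ 2 * S.size n k := fun k => by
    by_cases h : a ≤ S.rank n k ∧ S.rank n k ≤ b
    · obtain ⟨s, hs⟩ := exists_mem_subModels_norm_starProjection_le hsub (k := k) hη
        (by omega) (hη0.trans_le (hDk k h.1 h.2)) (hN3 k h.1 h.2)
      exact ⟨s, fun _ _ => hs⟩
    · exact ⟨k, fun h1 h2 => absurd ⟨h1, h2⟩ h⟩
  choose s hs using hex
  rw [Finset.mul_sum, ENNReal.ofReal_sum_of_nonneg fun j _ => by positivity]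
  refine le_trans (measure_mono (t := _ ∪ ⋃ j ∈ Finset.Icc a b,
      ⋃ k ∈ {k : Γ n | S.rank n k = j}, S.deviationSet n η k (s k)) ?_)
    ((measure_union_le _ _).trans (add_le_add_right
    ((measure_biUnion_finset_le (Finset.Icc a b) _).trans (Finset.sum_le_sum fun j hj => ?_)) _))
  rotate_left
  · rw [Finset.mem_Icc] at hj
    exact S.measure_biUnion_rank_le hsub hη (by linarith) hn (by omega) (by omega)
      (hη0.trans_le (hB j hj.1 hj.2)) (hBm j hj.1 hj.2) hζ hc₀ (hN j hj.1 hj.2).1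
      (hN j hj.1 hj.2).2 s fun k hk => (hs k (hk ▸ hj.1) (hk ▸ hj.2)).1
  · intro ω hω
    by_contra hcon
    rw [Set.mem_union, not_or, Set.notMem_compl_iff] at hcon
    obtain ⟨⟨hra, hrb⟩, hgood⟩ := hcon
    simp only [deviationSet, Set.mem_union, Set.mem_ofPred_eq, not_or, Set.mem_iUnion,
      Finset.mem_Icc, exists_prop, not_exists, not_and, not_le] at hgood
    obtain ⟨⟨h1, h2⟩, h3⟩ := hgood _ ⟨hra, hrb⟩ _ rfl
    obtain ⟨hsm, hsn⟩ := hs _ hra hrb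
    have hD := hDk _ hra hrb
    have hr : 1 < S.rank n (khat ω) := by omega
    have hra' : (a : ℝ) ≤ S.rank n (khat ω) := by exact_mod_cast hra
    have h := abs_IC_div_IC_sub_one_le hsm hη1 (hη0.trans_le hD) h1 h2 h3 hsn
      (zero_le_one.trans (S.one_le_lam_mul_log hn))
      (S.lam_mul_log_le_mul_size hη (haη.trans hra') hD)
    have h' := abs_le.mp h
    refine hω ⟨S.PI_lt hr hsm (abs_lt.mpr ⟨by linarith, by linarith⟩),
      S.signedPI_lt hr hsm (by linarith) (by linarith)⟩

theorem tendsto_measure_not_index_lt [IsProbabilityMeasure μ] [∀ n, Countable (Γ n)]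
    (hsub : S.HasSubModels) {khat : (n : ℕ) → Ω → Γ n}
    (hkhat : ∀ n k, MeasurableSet {ω | khat n ω = k}) {c : ℝ} (hc : 1 < c) (hN : S.CondN khat) :
    Tendsto (fun n => μ {ω | ¬(S.PI n (khat n) ω < c ∧ S.signedPI n (khat n) ω < c)})
      atTop (𝓝 0) := by
  obtain ⟨a, b, hab, ha, ⟨hr, hB⟩, ⟨⟨ζ, c₀, -, hζ, hc₀, hcount⟩, hsum⟩, hN3⟩ := hN
  obtain ⟨η, hη, hη1, hηc⟩ : ∃ η : ℝ, 0 < η ∧ η ≤ 3 / 100 ∧ 200 * η < c - 1 :=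
    ⟨min (3 / 100) ((c - 1) / 400), lt_min (by norm_num) (by linarith), min_le_left _ _, by
      linarith [min_le_right (3 / 100 : ℝ) ((c - 1) / 400)]⟩
  have hδ : 0 < min (1 / 50 : ℝ) (η ^ 2 / 2) := lt_min (by norm_num) (by positivity)
  have hmeas : ∀ n, MeasurableSet
      {ω | a n ≤ S.rank n (khat n ω) ∧ S.rank n (khat n ω) ≤ b n} := fun n => by
    have : {ω | a n ≤ S.rank n (khat n ω) ∧ S.rank n (khat n ω) ≤ b n}
        = ⋃ k ∈ {k : Γ n | a n ≤ S.rank n k ∧ S.rank n k ≤ b n}, {ω | khat n ω = k} := by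
      ext ω; simp
    rw [this]
    exact MeasurableSet.biUnion (Set.to_countable _) fun k _ => hkhat n k
  have hlim : Tendsto (fun n =>
      μ {ω | a n ≤ S.rank n (khat n ω) ∧ S.rank n (khat n ω) ≤ b n}ᶜ
        + ENNReal.ofReal (6 * c₀ * ∑ j ∈ Finset.Icc (a n) (b n),
            Real.exp (-(S.B n j ^ 2 / (10 * ((n : ℝ) - j)))))) atTop (𝓝 0) := by
    have h1 : Tendsto (fun n =>
        μ {ω | a n ≤ S.rank n (khat n ω) ∧ S.rank n (khat n ω) ≤ b n}ᶜ) atTop (𝓝 0) := by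
      simp_rw [fun n => prob_compl_eq_one_sub (μ := μ) (hmeas n)]
      simpa using ENNReal.Tendsto.sub (tendsto_const_nhds (x := (1 : ℝ≥0∞))) hr
        (Or.inl ENNReal.one_ne_top)
    have h2 := ENNReal.tendsto_ofReal (hsum.const_mul (6 * c₀))
    simpa using h1.add h2
  refine tendsto_of_tendsto_of_tendsto_of_le_of_le' tendsto_const_nhds hlim
    (Eventually.of_forall fun _ => zero_le) ?_
  filter_upwards [hab, ha.eventually_ge_atTop 2,
    (tendsto_natCast_atTop_atTop (R := ℝ).comp ha).eventually_ge_atTop (1 / (2 * η)),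
    hB _ hδ, hcount, hN3 (η * S.σ ^ 2 / 2) (by have := S.σ_pos; positivity),
    hζ.eventually_le_const (show 0 < η ^ 2 / 16 by positivity),
    hsum.eventually_le_const (Real.exp_pos (-(1 / (2 * η)))), eventually_ge_atTop 2]
    with n h1 h2 h3 h4 h5 h6 h7 h8 hn
  refine S.measure_not_index_lt_le hsub (khat n) hη hη1 hηc hn h2 h3 h1.2.2 h7 hc₀.le
    (fun j haj hjb => ?_) h4 h5 h6
  have hle : Real.exp (-(S.B n j ^ 2 / (10 * ((n : ℝ) - j)))) ≤ Real.exp (-(1 / (2 * η))) :=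
    (Finset.single_le_sum (f := fun j => Real.exp (-(S.B n j ^ 2 / (10 * ((n : ℝ) - j)))))
      (fun _ _ => (Real.exp_pos _).le) (Finset.mem_Icc.mpr ⟨haj, hjb⟩)).trans h8
  rw [Real.exp_le_exp, neg_le_neg_iff] at hle
  refine hle.trans ?_
  have hm0 : (0 : ℝ) < (n : ℝ) - j := sub_pos.mpr (by exact_mod_cast hjb.trans_lt h1.2.2)
  have hB0 := S.B_nonneg hn j
  have hq := (h4 j haj hjb).trans (min_le_left _ _)
  calc S.B n j ^ 2 / (10 * ((n : ℝ) - j)) = S.B n j * (S.B n j / ((n : ℝ) - j)) / 10 := by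
        field_simp
    _ ≤ S.B n j := by nlinarith

/-! ### The parametric scenario -/

section TrueModel

variable {S} {n : ℕ} {k : Γ n} (hf : S.f n ∈ S.family n k)
include hf

theorem proj_mean_of_mem : S.proj n k (S.mean n) = S.mean n :=
  Submodule.starProjection_eq_self_iff.mpr (Submodule.mem_map_of_mem hf)

theorem IC_of_mem (ω : Ω) :
    S.IC n k ω = S.σ ^ 2 * ((S.lam n * Real.log n - 1) * S.rank n k
      + S.d * Real.sqrt n * Real.log n
      + (‖(S.colSpace n k)ᗮ.starProjection (S.noise n ω)‖ ^ 2 - (n - S.rank n k : ℕ))) := by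
  rw [IC_eq, scaledBias, size, approxErr, proj_mean_of_mem hf]
  simp

theorem abs_IC_of_mem_le {x : ℝ} {ω : Ω} (hn : 2 ≤ n)
    (h1 : S.rank n k * S.lam n * Real.log n ≤ x) (h2 : S.d * Real.sqrt n * Real.log n ≤ x)
    (h3 : |‖(S.colSpace n k)ᗮ.starProjection (S.noise n ω)‖ ^ 2 - (n - S.rank n k : ℕ)| < x) :
    |S.IC n k ω| ≤ S.σ ^ 2 * (3 * x) := by
  rw [IC_of_mem hf, abs_mul, abs_of_nonneg (sq_nonneg S.σ)]
  have h4 := mul_nonneg (sub_nonneg.mpr (S.one_le_lam_mul_log hn)) (S.rank n k).cast_nonneg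
  have h5 := S.penalty_nonneg n
  have h6 : (0 : ℝ) ≤ S.rank n k := Nat.cast_nonneg _
  have h7 := abs_lt.mp h3
  gcongr
  rw [abs_le]
  constructor <;> linarith

theorem mul_abs_IC_le_IC_subModel {s : Γ n} (hs : s ∈ S.subModels n k) {x y c : ℝ} {ω : Ω}
    (hn : 2 ≤ n) (hc : 0 ≤ c)
    (h1 : S.rank n k * S.lam n * Real.log n ≤ x) (h2 : S.d * Real.sqrt n * Real.log n ≤ x)
    (h3 : |‖(S.colSpace n k)ᗮ.starProjection (S.noise n ω)‖ ^ 2 - (n - S.rank n k : ℕ)| < x)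
    (h4 : ‖(S.colSpace n k).starProjection (S.noise n ω)‖ ^ 2 < x)
    (h5 : y ≤ S.approxErr n s / S.σ ^ 2) (hxy : (5 + 3 * c) * x ≤ y / 2) :
    c * |S.IC n k ω| ≤ S.IC n s ω := by
  have hσ : 0 < S.σ ^ 2 := pow_pos S.σ_pos 2
  have h6 := abs_IC_of_mem_le hf hn h1 h2 h3
  have h7 := S.le_norm_starProjection_response_sq n ω (S.diffSpace n k s)
  have h8 : ‖(S.diffSpace n k s).starProjection (S.mean n)‖ ^ 2 = S.approxErr n s := by
    rw [starProjection_diffSpace hs, proj_mean_of_mem hf, approxErr]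
  have h9 : ‖(S.diffSpace n k s).starProjection (S.noise n ω)‖ ^ 2
      ≤ ‖(S.colSpace n k).starProjection (S.noise n ω)‖ ^ 2 := by
    gcongr
    have hle : S.diffSpace n k s ≤ S.colSpace n k := inf_le_right
    rw [← Submodule.starProjection_comp_starProjection_of_le hle]
    exact Submodule.norm_starProjection_apply_le _ _
  have hr : (1 : ℝ) ≤ S.rank n k := by exact_mod_cast hs.2 ▸ Nat.le_add_left 1 _
  have h10 : S.lam n * Real.log n ≤ x := by
    have := S.one_le_lam_mul_log hn
    nlinarith
  rw [le_div_iff₀ hσ] at h5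
  rw [IC_subModel hs]
  have h11 : S.lam n * Real.log n * S.σ ^ 2 ≤ x * S.σ ^ 2 := by gcongr
  have h12 : S.σ ^ 2 * ‖(S.diffSpace n k s).starProjection (S.noise n ω)‖ ^ 2 ≤ S.σ ^ 2 * x := by
    gcongr; exact h9.trans h4.le
  have h13 : c * |S.IC n k ω| ≤ c * (S.σ ^ 2 * (3 * x)) := by gcongr
  have h14 : (5 + 3 * c) * x * S.σ ^ 2 ≤ y / 2 * S.σ ^ 2 := by gcongr
  linarith [neg_abs_le (S.IC n k ω)]

theorem measure_IC_eq_zero (hk : S.rank n k < n) : μ {ω | S.IC n k ω = 0} = 0 := by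
  refine measure_mono_null (fun ω hω => ?_) (measure_norm_starProjection_sq_eq (S.hasLaw_noise n)
    (S.colSpace n k)ᗮ (by rw [finrank_orthogonal_colSpace]; omega)
    ((n - S.rank n k : ℕ) - ((S.lam n * Real.log n - 1) * S.rank n k
      + S.d * Real.sqrt n * Real.log n)))
  have hω : S.IC n k ω = 0 := hω
  rw [IC_of_mem hf, mul_eq_zero, or_iff_right (pow_pos S.σ_pos 2).ne'] at hω
  simp only [Set.mem_ofPred_eq]
  linarith

end TrueModel

theorem measure_le_abs_norm_starProjection_orthogonal_sub_le_exp {n : ℕ} {k : Γ n} {x : ℝ}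
    (hk : S.rank n k < n) (hx : 0 ≤ x) (hxm : x ≤ ((n - S.rank n k : ℕ) : ℝ) / 8) :
    μ {ω | x ≤ |‖(S.colSpace n k)ᗮ.starProjection (S.noise n ω)‖ ^ 2 - (n - S.rank n k : ℕ)|}
      ≤ ENNReal.ofReal (2 * Real.exp (-(x ^ 2 / (8 * n)))) := by
  have hmn : ((n - S.rank n k : ℕ) : ℝ) ≤ n := by exact_mod_cast Nat.sub_le _ _
  have hfin := S.finrank_orthogonal_colSpace n k
  have hm0 : 0 < n - S.rank n k := by omega
  generalize n - S.rank n k = m at *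
  have hm' : (0 : ℝ) < m := by exact_mod_cast hm0
  refine (measure_le_abs_norm_starProjection_sq_sub_le (S.hasLaw_noise n) _
    hfin hm0 hx (by linarith)).trans (ENNReal.ofReal_le_ofReal ?_)
  gcongr
  have h1 : 4 * x / m ≤ 1 / 2 := by rw [div_le_iff₀ hm']; linarith
  calc x ^ 2 / (8 * n) ≤ x ^ 2 / (8 * m) := by gcongr
    _ = x ^ 2 / (4 * m) * (1 / 2) := by field_simp; ring
    _ ≤ _ := by gcongr; linarith

theorem le_PI {n : ℕ} {khat : Ω → Γ n} {ω : Ω} {c : ℝ} (hsub : S.HasSubModels)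
    (hr : 1 < S.rank n (khat ω)) (h0 : S.IC n (khat ω) ω ≠ 0)
    (h : ∀ s ∈ S.subModels n (khat ω), c * |S.IC n (khat ω) ω| ≤ S.IC n s ω) :
    c ≤ S.PI n khat ω := by
  have := (hsub n _ hr).to_subtype
  rw [PI, if_pos hr]
  refine le_ciInf fun s => ?_
  rw [abs_div, le_div_iff₀ (abs_pos.mpr h0)]
  exact (h s s.2).trans (le_abs_self _)

theorem le_signedPI {n : ℕ} {khat : Ω → Γ n} {ω : Ω} {c : ℝ} (hsub : S.HasSubModels)
    (hr : 1 < S.rank n (khat ω)) (h0 : 0 < S.IC n (khat ω) ω)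
    (h : ∀ s ∈ S.subModels n (khat ω), c * |S.IC n (khat ω) ω| ≤ S.IC n s ω) :
    c ≤ S.signedPI n khat ω := by
  have := (hsub n _ hr).to_subtype
  rw [signedPI, if_pos hr]
  refine le_ciInf fun s => ?_
  rw [le_div_iff₀ h0]
  simpa [abs_of_pos h0] using h s s.2

theorem A_le (kstar : (n : ℕ) → Γ n) {n : ℕ} {s : Γ n} (hs : s ∈ S.subModels n (kstar n)) :
    S.A kstar n ≤ S.approxErr n s / S.σ ^ 2 :=
  ciInf_le (f := fun k : S.subModels n (kstar n) => S.approxErr n k / S.σ ^ 2)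
    ⟨0, by rintro _ ⟨k, rfl⟩; exact div_nonneg (S.approxErr_nonneg n k) (sq_nonneg _)⟩ ⟨s, hs⟩

theorem exists_mul_rpow_le_A {kstar : (n : ℕ) → Γ n} {τ : ℝ} (h : S.CondP1 kstar τ) :
    ∃ κ : ℝ, 0 < κ ∧ ∀ᶠ n : ℕ in atTop, κ * (n : ℝ) ^ (1 / 2 + τ) ≤ S.A kstar n := by
  obtain ⟨C, hC, hb⟩ := h.exists_pos
  refine ⟨C⁻¹, inv_pos.mpr hC, hb.bound.mono fun n hn => ?_⟩
  have hA : 0 ≤ S.A kstar n :=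
    Real.iInf_nonneg fun k => div_nonneg (S.approxErr_nonneg n k) (sq_nonneg _)
  rw [Real.norm_of_nonneg (by positivity), Real.norm_of_nonneg hA] at hn
  rwa [inv_mul_le_iff₀ hC]

theorem eventually_rank_mul_le {kstar : (n : ℕ) → Γ n} {τ ε : ℝ} (h : S.CondP2 kstar τ)
    (hε : 0 < ε) : ∀ᶠ n : ℕ in atTop,
      S.rank n (kstar n) * S.lam n * Real.log n ≤ ε * (n : ℝ) ^ (1 / 2 + τ) := by
  filter_upwards [h.def hε] with n hn
  rw [Real.norm_of_nonneg (r := (n : ℝ) ^ (1 / 2 + τ)) (by positivity)] at hn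
  exact (le_abs_self _).trans hn

theorem rank_le_of_rank_mul_le {n : ℕ} (hn : 2 ≤ n) {k : Γ n} {x : ℝ}
    (h : S.rank n k * S.lam n * Real.log n ≤ x) : (S.rank n k : ℝ) ≤ x := by
  have := S.one_le_lam_mul_log hn
  have : (0 : ℝ) ≤ S.rank n k := Nat.cast_nonneg _
  nlinarith

theorem eventually_rank_le_div {kstar : (n : ℕ) → Γ n} {τ : ℝ} (hτ : τ ≤ 1 / 2)
    (h : S.CondP2 kstar τ) : ∀ᶠ n : ℕ in atTop,
      (S.rank n (kstar n) : ℝ) ≤ n / 2 ∧ S.rank n (kstar n) < n := by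
  filter_upwards [S.eventually_rank_mul_le h one_half_pos, eventually_ge_atTop 2] with n h1 hn
  have hn' : (2 : ℝ) ≤ n := by exact_mod_cast hn
  have h2 : (n : ℝ) ^ (1 / 2 + τ) ≤ n :=
    (Real.rpow_le_rpow_of_exponent_le (by linarith) (by linarith)).trans_eq (Real.rpow_one _)
  have h3 : (S.rank n (kstar n) : ℝ) ≤ n / 2 :=
    (S.rank_le_of_rank_mul_le hn h1).trans (by linarith)
  exact ⟨h3, by exact_mod_cast h3.trans_lt (by linarith : (n : ℝ) / 2 < n)⟩

theorem tendsto_ofReal_two_mul_exp_neg {u : ℕ → ℝ} (hu : Tendsto u atTop atTop) :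
    Tendsto (fun n => ENNReal.ofReal (2 * Real.exp (-u n))) atTop (𝓝 0) := by
  simpa using ENNReal.tendsto_ofReal ((Real.tendsto_exp_neg_atTop_nhds_zero.comp hu).const_mul 2)

theorem tendsto_measure_not_mul_abs_IC_le {kstar : (n : ℕ) → Γ n} {τ c : ℝ} (hτ : 0 < τ)
    (hτ2 : τ ≤ 1 / 2) (hc : 0 ≤ c) (hpar : S.Parametric kstar) (h1 : S.CondP1 kstar τ)
    (h2 : S.CondP2 kstar τ) :
    Tendsto (fun n => μ {ω | ¬ ∀ s ∈ S.subModels n (kstar n),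
      c * |S.IC n (kstar n) ω| ≤ S.IC n s ω}) atTop (𝓝 0) := by
  obtain ⟨κ, hκ, hA⟩ := S.exists_mul_rpow_le_A h1
  obtain ⟨ε, hε, hε1, hεκ⟩ : ∃ ε : ℝ, 0 < ε ∧ ε ≤ 1 / 16 ∧ (5 + 3 * c) * ε ≤ κ / 2 := by
    refine ⟨min (1 / 16) (κ / 2 / (5 + 3 * c)), lt_min (by norm_num) (by positivity),
      min_le_left _ _, ?_⟩
    rw [← le_div_iff₀' (by positivity)]
    exact min_le_right _ _
  have hpen : ∀ᶠ n : ℕ in atTop,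
      S.d * Real.sqrt n * Real.log n ≤ ε * (n : ℝ) ^ (1 / 2 + τ) := by
    have h := ((isLittleO_log_rpow_atTop hτ).comp_tendsto
      (tendsto_natCast_atTop_atTop (R := ℝ))).const_mul_left S.d
    filter_upwards [h.def hε] with n hn
    simp only [Function.comp_apply] at hn
    rw [Real.norm_of_nonneg (r := (n : ℝ) ^ τ) (by positivity)] at hn
    rw [Real.rpow_add_of_nonneg n.cast_nonneg (by norm_num) hτ.le, ← Real.sqrt_eq_rpow]
    have := mul_le_mul_of_nonneg_left ((le_abs_self _).trans hn) (Real.sqrt_nonneg n)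
    linarith
  have hlim1 : Tendsto (fun n : ℕ => ε * (n : ℝ) ^ (1 / 2 + τ) / 8) atTop atTop :=
    (((tendsto_rpow_atTop (by positivity)).comp tendsto_natCast_atTop_atTop).const_mul_atTop
      hε).atTop_div_const (by norm_num)
  have hlim2 : Tendsto (fun n : ℕ => (ε * (n : ℝ) ^ (1 / 2 + τ)) ^ 2 / (8 * n)) atTop atTop := by
    have h : Tendsto (fun n : ℕ => ε ^ 2 / 8 * (n : ℝ) ^ (2 * τ)) atTop atTop :=
      ((tendsto_rpow_atTop (by positivity)).comp tendsto_natCast_atTop_atTop).const_mul_atTop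
        (by positivity)
    refine h.congr' ?_
    filter_upwards [eventually_ge_atTop 1] with n hn
    have hn' : (0 : ℝ) < n := by exact_mod_cast hn
    rw [mul_pow, ← Real.rpow_mul_natCast n.cast_nonneg,
      show (1 / 2 + τ) * ((2 : ℕ) : ℝ) = 1 + 2 * τ by push_cast; ring, Real.rpow_add hn',
      Real.rpow_one]
    field_simp
  have hlim := (tendsto_ofReal_two_mul_exp_neg hlim1).add (tendsto_ofReal_two_mul_exp_neg hlim2)
  rw [add_zero] at hlim
  refine tendsto_of_tendsto_of_tendsto_of_le_of_le' tendsto_const_nhds hlim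
    (Eventually.of_forall fun _ => zero_le) ?_
  filter_upwards [hpar, hA, hpen, S.eventually_rank_mul_le h2 (show 0 < ε / 4 by positivity),
    S.eventually_rank_le_div hτ2 h2, eventually_ge_atTop 2] with n hp hAn hpn hrn hr2 hn
  have hn' : (2 : ℝ) ≤ n := by exact_mod_cast hn
  have hF : (n : ℝ) ^ (1 / 2 + τ) ≤ n :=
    (Real.rpow_le_rpow_of_exponent_le (by linarith) (by linarith)).trans_eq (Real.rpow_one _)
  have hF0 : 0 < (n : ℝ) ^ (1 / 2 + τ) := by positivity
  set F := (n : ℝ) ^ (1 / 2 + τ)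
  have hx : 0 < ε * F := by positivity
  have hm : ((n - S.rank n (kstar n) : ℕ) : ℝ) = n - S.rank n (kstar n) :=
    Nat.cast_sub (S.rank_le n _)
  have e1 := measure_le_norm_starProjection_sq_le (S.hasLaw_noise n) (S.colSpace n (kstar n))
    (ε * F)
  have e1' : ENNReal.ofReal (Real.exp
      ((Module.finrank ℝ (S.colSpace n (kstar n)) : ℝ) / 2 - ε * F / 4))
        ≤ ENNReal.ofReal (2 * Real.exp (-(ε * F / 8))) := by
    apply ENNReal.ofReal_le_ofReal
    have h3 := S.rank_le_of_rank_mul_le hn hrn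
    rw [rank] at h3
    have h4 := Real.exp_le_exp.mpr (show
      (Module.finrank ℝ (S.colSpace n (kstar n)) : ℝ) / 2 - ε * F / 4 ≤ -(ε * F / 8) by linarith)
    linarith [Real.exp_pos (-(ε * F / 8))]
  have e2 := S.measure_le_abs_norm_starProjection_orthogonal_sub_le_exp hr2.2 hx.le
    (by rw [hm]; nlinarith [hr2.1])
  refine le_trans (measure_mono (fun ω hω => ?_))
    ((measure_union_le _ _).trans (add_le_add (e1.trans e1') e2))
  by_contra hcon
  simp only [Set.mem_union, Set.mem_ofPred_eq, not_or, not_le] at hcon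
  refine hω fun s hs => ?_
  refine mul_abs_IC_le_IC_subModel hp.1 hs hn hc (x := ε * F) (y := κ * F) (by linarith) hpn
    hcon.2 hcon.1 (hAn.trans (S.A_le kstar hs)) ?_
  nlinarith

theorem tendsto_measure_IC_nonpos {kstar : (n : ℕ) → Γ n} {τ : ℝ} (hd : 0 < S.d)
    (hτ2 : τ ≤ 1 / 2) (hpar : S.Parametric kstar) (h2 : S.CondP2 kstar τ) :
    Tendsto (fun n => μ {ω | S.IC n (kstar n) ω ≤ 0}) atTop (𝓝 0) := by
  have hlog : Tendsto (fun n : ℕ => Real.log n) atTop atTop :=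
    Real.tendsto_log_atTop.comp tendsto_natCast_atTop_atTop
  have hu : Tendsto (fun n : ℕ => (S.d * Real.sqrt n * Real.log n) ^ 2 / (8 * n))
      atTop atTop := by
    refine (((tendsto_pow_atTop two_ne_zero).comp hlog).const_mul_atTop
      (show 0 < S.d ^ 2 / 8 by positivity)).congr' ?_
    filter_upwards [eventually_ge_atTop 1] with n hn
    have hn' : (0 : ℝ) < n := by exact_mod_cast hn
    simp only [Function.comp_apply]
    rw [mul_pow, mul_pow, Real.sq_sqrt hn'.le]
    field_simp
  refine tendsto_of_tendsto_of_tendsto_of_le_of_le' tendsto_const_nhds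
    (tendsto_ofReal_two_mul_exp_neg hu) (Eventually.of_forall fun _ => zero_le) ?_
  have hpen := ((isLittleO_log_rpow_atTop (show (0 : ℝ) < 1 / 2 by norm_num)).comp_tendsto
    (tendsto_natCast_atTop_atTop (R := ℝ))).const_mul_left S.d
  filter_upwards [hpar, hpen.def (show (0 : ℝ) < 1 / 16 by norm_num),
    S.eventually_rank_le_div hτ2 h2, eventually_ge_atTop 2] with n hp hpn hr2 hn
  have hm : ((n - S.rank n (kstar n) : ℕ) : ℝ) = n - S.rank n (kstar n) :=
    Nat.cast_sub (S.rank_le n _)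
  simp only [Function.comp_apply] at hpn
  rw [← Real.sqrt_eq_rpow, Real.norm_of_nonneg (Real.sqrt_nonneg _)] at hpn
  have h3 := mul_le_mul_of_nonneg_left ((le_abs_self _).trans hpn) (Real.sqrt_nonneg n)
  have h4 := Real.mul_self_sqrt (Nat.cast_nonneg (α := ℝ) n)
  refine le_trans (measure_mono fun ω hω => ?_)
    (S.measure_le_abs_norm_starProjection_orthogonal_sub_le_exp hr2.2 (S.penalty_nonneg n)
      (by rw [hm]; nlinarith [hr2.1]))
  have hω : S.IC n (kstar n) ω ≤ 0 := hω
  rw [IC_of_mem hp.1] at hω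
  have h5 := nonpos_of_mul_nonpos_right hω (pow_pos S.σ_pos 2)
  have h6 := mul_nonneg (sub_nonneg.mpr (S.one_le_lam_mul_log hn))
    (S.rank n (kstar n)).cast_nonneg
  simp only [Set.mem_ofPred_eq]
  refine le_trans ?_ (neg_le_abs _)
  linarith

theorem tendsto_measure_ne [IsProbabilityMeasure μ] {kstar : (n : ℕ) → Γ n}
    {khat : (n : ℕ) → Ω → Γ n} (hkhat : ∀ n k, MeasurableSet {ω | khat n ω = k})
    (h3 : S.CondP3 kstar khat) :
    Tendsto (fun n => μ {ω | khat n ω = kstar n}ᶜ) atTop (𝓝 0) := by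
  simp_rw [fun n => prob_compl_eq_one_sub (μ := μ) (hkhat n (kstar n))]
  simpa using ENNReal.Tendsto.sub (tendsto_const_nhds (x := (1 : ℝ≥0∞))) h3
    (Or.inl ENNReal.one_ne_top)

theorem tendsto_measure_PI_lt [IsProbabilityMeasure μ] (hsub : S.HasSubModels)
    {kstar : (n : ℕ) → Γ n} {khat : (n : ℕ) → Ω → Γ n}
    (hkhat : ∀ n k, MeasurableSet {ω | khat n ω = k}) {c : ℝ} (hc : 0 ≤ c)
    (hpar : S.Parametric kstar) (hP : S.CondP kstar khat) :
    Tendsto (fun n => μ {ω | S.PI n (khat n) ω < c}) atTop (𝓝 0) := by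
  obtain ⟨⟨τ, hτ, hτ2, h1, h2⟩, h3⟩ := hP
  have hlim := (S.tendsto_measure_ne hkhat h3).add
    (S.tendsto_measure_not_mul_abs_IC_le hτ hτ2 hc hpar h1 h2)
  rw [add_zero] at hlim
  refine tendsto_of_tendsto_of_tendsto_of_le_of_le' tendsto_const_nhds hlim
    (Eventually.of_forall fun _ => zero_le) ?_
  filter_upwards [hpar, S.eventually_rank_le_div hτ2 h2] with n hp hr
  refine le_trans (measure_mono (t := ({ω | khat n ω = kstar n}ᶜ ∪ {ω | ¬ ∀ s ∈
      S.subModels n (kstar n), c * |S.IC n (kstar n) ω| ≤ S.IC n s ω}) ∪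
      {ω | S.IC n (kstar n) ω = 0}) fun ω hω => ?_)
    ((measure_union_le _ _).trans ?_)
  · by_contra hcon
    simp only [Set.mem_union, not_or, Set.notMem_compl_iff, Set.mem_ofPred_eq, not_not] at hcon
    obtain ⟨⟨he, hall⟩, h0⟩ := hcon
    rw [← he] at hall h0 hp
    exact (not_lt.mpr (S.le_PI hsub hp.2 h0 hall)) hω
  · rw [measure_IC_eq_zero hp.1 hr.2, add_zero]
    exact measure_union_le _ _

theorem tendsto_measure_signedPI_lt [IsProbabilityMeasure μ] (hsub : S.HasSubModels)
    {kstar : (n : ℕ) → Γ n} {khat : (n : ℕ) → Ω → Γ n}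
    (hkhat : ∀ n k, MeasurableSet {ω | khat n ω = k}) {c : ℝ} (hc : 0 ≤ c)
    (hpar : S.Parametric kstar) (hP : S.CondP kstar khat) (hd : 0 < S.d) :
    Tendsto (fun n => μ {ω | S.signedPI n (khat n) ω < c}) atTop (𝓝 0) := by
  obtain ⟨⟨τ, hτ, hτ2, h1, h2⟩, h3⟩ := hP
  have hlim := ((S.tendsto_measure_ne hkhat h3).add
    (S.tendsto_measure_not_mul_abs_IC_le hτ hτ2 hc hpar h1 h2)).add
    (S.tendsto_measure_IC_nonpos hd hτ2 hpar h2)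
  rw [add_zero, add_zero] at hlim
  refine tendsto_of_tendsto_of_tendsto_of_le_of_le' tendsto_const_nhds hlim
    (Eventually.of_forall fun _ => zero_le) ?_
  filter_upwards [hpar] with n hp
  refine le_trans (measure_mono fun ω hω => ?_)
    ((measure_union_le _ _).trans (add_le_add_left (measure_union_le _ _) _))
  by_contra hcon
  simp only [Set.mem_union, not_or, Set.notMem_compl_iff, Set.mem_ofPred_eq, not_not,
    not_le] at hcon
  obtain ⟨⟨he, hall⟩, h0⟩ := hcon
  rw [← he] at hall h0 hp
  exact (not_lt.mpr (S.le_signedPI hsub hp.2 h0 hall)) hω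

/-! ### Loss efficiency of the combined procedure -/

/-- A procedure that agrees with a loss efficient one with probability tending to one is loss
efficient. -/
theorem LossEfficient.of_measure_ne {S : RegressionSetup μ X Γ} {sel sel' : (n : ℕ) → Ω → Γ n}
    (h : S.LossEfficient sel) {T : ℕ → Set Ω} (hT : Tendsto (fun n => μ (T n)) atTop (𝓝 0))
    (he : ∀ n ω, ω ∉ T n → sel' n ω = sel n ω) : S.LossEfficient sel' := fun ε hε => by
  have hlim := (h ε hε).add hT
  rw [add_zero] at hlim
  refine tendsto_of_tendsto_of_tendsto_of_le_of_le tendsto_const_nhds hlim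
    (fun _ => zero_le) fun n => le_trans (measure_mono fun ω hω => ?_) (measure_union_le _ _)
  by_cases hω' : ω ∈ T n
  · exact Or.inr hω'
  · refine Or.inl ?_
    simp only [Set.mem_ofPred_eq] at hω ⊢
    rwa [he n ω hω'] at hω

end RegressionSetup

theorem mainTheorem5 {Ω : Type*} [MeasurableSpace Ω] (μ : Measure Ω) [IsProbabilityMeasure μ]
    {X : Type*} {Γ : ℕ → Type*} [∀ n, Countable (Γ n)]
    (S : RegressionSetup μ X Γ) (hsub : S.HasSubModels)
    (khat kAIC kBIC : (n : ℕ) → Ω → Γ n)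
    (hkhat : ∀ n k, MeasurableSet {ω | khat n ω = k})
    (hAIC : ∀ n ω, S.IsAICSelected n (kAIC n ω) ω)
    (hBIC : ∀ n ω, S.IsBICSelected n (kBIC n ω) ω)
    (c : ℝ) (hc : 1 < c) :
    (∀ kstar : (n : ℕ) → Γ n, S.Parametric kstar → S.CondP kstar khat → S.LossEfficient kBIC →
      S.LossEfficient (combineSel c (fun n => S.PI n (khat n)) kAIC kBIC) ∧
      (0 < S.d →
        S.LossEfficient (combineSel c (fun n => S.signedPI n (khat n)) kAIC kBIC))) ∧
    (S.Nonparametric → S.CondN khat → S.LossEfficient kAIC →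
      S.LossEfficient (combineSel c (fun n => S.PI n (khat n)) kAIC kBIC) ∧
      S.LossEfficient (combineSel c (fun n => S.signedPI n (khat n)) kAIC kBIC)) := by
  have hBsel : ∀ index : (n : ℕ) → Ω → ℝ, S.LossEfficient kBIC →
      Tendsto (fun n => μ {ω | index n ω < c}) atTop (𝓝 0) →
      S.LossEfficient (combineSel c index kAIC kBIC) := fun index hB hT =>
    hB.of_measure_ne hT fun n ω hω => if_neg hω
  have hAsel : ∀ index : (n : ℕ) → Ω → ℝ, S.LossEfficient kAIC →
      Tendsto (fun n => μ {ω | ¬ index n ω < c}) atTop (𝓝 0) →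
      S.LossEfficient (combineSel c index kAIC kBIC) := fun index hA hT =>
    hA.of_measure_ne hT fun n ω hω => if_pos (not_not.mp hω)
  have hc0 : 0 ≤ c := by linarith
  refine ⟨fun kstar hpar hP hB =>
    ⟨hBsel _ hB (S.tendsto_measure_PI_lt hsub hkhat hc0 hpar hP), fun hd =>
      hBsel _ hB (S.tendsto_measure_signedPI_lt hsub hkhat hc0 hpar hP hd)⟩,
    fun _ hN hA => ?_⟩
  have h := S.tendsto_measure_not_index_lt hsub hkhat hc hN
  have hle : ∀ index : (n : ℕ) → Ω → ℝ, (∀ n ω, S.PI n (khat n) ω < c ∧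
      S.signedPI n (khat n) ω < c → index n ω < c) →
      Tendsto (fun n => μ {ω | ¬ index n ω < c}) atTop (𝓝 0) := fun index hi =>
    tendsto_of_tendsto_of_tendsto_of_le_of_le tendsto_const_nhds h (fun _ => zero_le)
      fun n => measure_mono fun ω hω hcon => hω (hi n ω hcon)
  exact ⟨hAsel _ hA (hle _ fun _ _ h => h.1), hAsel _ hA (hle _ fun _ _ h => h.2)⟩

end
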